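/- **Theorem 4.1.** Fix $\tau\in(0,1)$ and integers $0\le k_1<K_1$, $0\le k_2<K_2$. For $p_1,p_2,T\ge 1$ let $$X_{ijt}=r_{0i}'F_{0t}c_{0j}+\varepsilon_{ijt},\qquad 1\le i\le p_1,\ 1\le j\le p_2,\ 1\le t\le T,$$ with nonrandom loadings $r_{0i}\in\mathbb R^{k_1}$, $c_{0j}\in\mathbb R^{k_2}$ and random factor matrices $F_{0t}\in\mathbb R^{k_1\times k_2}$, all of which may depend on $(p_1,p_2,T)$. For compact sets $\mathcal A\subset\mathbb R^{a}$, $\mathcal F\subset\mathbb R^{a\times b}$, $\mathcal B\subset\mathbb R^{b}$ let $\Theta(\mathcal A,\mathcal F,\mathcal B)$ be the set of all $\theta=(R,F_1,\dots,F_T,C)$ such that the rows $r_i'$ of $R\in\mathbb R^{p_1\times a}$ satisfy $r_i\in\mathcal A$, the rows $c_j'$ of $C\in\mathbb R^{p_2\times b}$ satisfy $c_j\in\mathcal B$, $F_t\in\mathcal F$ for all $t$, $R'R/p_1=\mathbb I_a$, $C'C/p_2=\mathbb I_b$, and $\frac1T\sum_tF_tF_t'$ and $\frac1T\sum_tF_t'F_t$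 are diagonal with non-increasing diagonal entries. Let $\Theta^{k_1k_2}$ and $\Theta^{K_1K_2}$ be the parameter spaces obtained from fixed compact sets (not depending on $p_1,p_2,T$) with $(a,b)=(k_1,k_2)$ and $(a,b)=(K_1,K_2)$ respectively. Assume, where (i) and (iii) are required for all sufficiently large $p_1,p_2,T$: 1. (i) $\theta_0=(R_0,F_{01},\dots,F_{0T},C_0)\in\Theta^{k_1k_2}$ almost surely, and $\Theta^{K_1K_2}$ contains the truth padded by zeros: there are nonrandom matrices $R$ with $K_1$ columns and $C$ with $K_2$ columns, whose first $k_1$ (respectively $k_2$) columns are those of $R_0$ (respectively $C_0$), such that almost surely $(R,\tilde F_{01},\dots,\tilde F_{0T},C)\in\Theta^{K_1K_2}$, where $\tilde F_{0t}=\begin{pmatrix}F_{0t}&0\\0&0\end{pmatrix}\in\mathbb R^{K_1\times K_2}$. (ii) There are constants $\sigma_1,\dots,\sigma_{k_1}>0$ and $\sigma_1',\dots,\sigma_{k_2}'>0$ such that, as $p_1,p_2,T\to\infty$, the $j$-th diagonal entry of $\frac1T\sum_tF_{0t}F_{0t}'$ converges in probability to $\sigma_j$ and that of $\frac1T\sum_tF_{0t}'F_{0t}$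 converges in probability to $\sigma'_j$. (iii) Given $(F_{01},\dots,F_{0T})$, the errors $\varepsilon_{ijt}$ are independent over $i,j,t$, and $\varepsilon_{ijt}$ has a conditional density $f_{ijt}$ with $P[\varepsilon_{ijt}\le0\mid F_{01},\dots,F_{0T}]=\tau$ a.s. (iv) For every compact $S\subset\mathbb R$ there is $\underline f>0$, not depending on $i,j,t,p_1,p_2,T$, such that for all sufficiently large $p_1,p_2,T$, almost surely, $f_{ijt}(u)\ge\underline f$ for all $u\in S$ and all $i,j,t$. 2. For all sufficiently large $p_1,p_2,T$, almost surely $\widehat\theta^{K_1K_2}=(\widehat R,\widehat F_1,\dots,\widehat F_T,\widehat C)$ minimizes $$\mathbb M_{p_1p_2T}(\theta)=\frac1{p_1p_2T}\sum_{i,j,t}\rho_\tau(X_{ijt}-r_i'F_tc_j),\qquad \rho_\tau(u)=u\,(\tau-\mathbf 1\{u<0\}),$$ over $\Theta^{K_1K_2}$ (any measurable choice of a minimizer). 3. With $L_{p_1p_2T}=\min\{\sqrt{p_1p_2},\sqrt{p_2T},\sqrt{p_1T}\}$, the nonrandom thresholds satisfy $C_{p_1p_2T}\to0$ and $C_{p_1p_2T}\,L_{p_1p_2T}^2\to\infty$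 as $p_1,p_2,T\to\infty$. Let $\widehat k_1^r$ and $\widehat k_2^r$ be the numbers of eigenvalues, counted with multiplicity, of $\frac1T\sum_t\widehat F_t\widehat F_t'$ and of $\frac1T\sum_t\widehat F_t'\widehat F_t$, respectively, that exceed $C_{p_1p_2T}$. Then, as $p_1,p_2,T\to\infty$ jointly (with no restriction on their relative rates), $$P(\widehat k_1^r=k_1,\ \widehat k_2^r=k_2)\to1 .$$ -/

import Mathlib

open MeasureTheory ProbabilityTheory Filter Topology

/-- The product (Borel) σ-algebra on real matrices. -/
instance instMeasurableSpaceMatrixReal {m n : Type*} : MeasurableSpace (Matrix m n ℝ) :=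
  inferInstanceAs (MeasurableSpace (m → n → ℝ))

/-- The check loss `ρ_τ(u) = u (τ - 1{u < 0})`. -/
noncomputable def checkLoss (τ u : ℝ) : ℝ := u * (τ - if u < 0 then 1 else 0)

/-- A parameter `θ = (R, F_1, …, F_T, C)` of the `p₁ × p₂` matrix factor model with `a` row
factors and `b` column factors; the rows of `R` and `C` are the loadings `r_i` and `c_j`. -/
structure FactorParam (p₁ p₂ T a b : ℕ) where
  R : Matrix (Fin p₁) (Fin a) ℝ
  F : Fin T → Matrix (Fin a) (Fin b) ℝ
  C : Matrix (Fin p₂) (Fin b) ℝ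

/-- The common component `r_i' F_t c_j = (R F_t C')_{ij}`. -/
def FactorParam.common {p₁ p₂ T a b : ℕ} (θ : FactorParam p₁ p₂ T a b)
    (i : Fin p₁) (j : Fin p₂) (t : Fin T) : ℝ :=
  (θ.R * θ.F t * θ.C.transpose) i j

/-- The row factor second-moment matrix `(1/T) ∑ F_t F_t'`. -/
noncomputable def rowMoment {T a b : ℕ} (F : Fin T → Matrix (Fin a) (Fin b) ℝ) :
    Matrix (Fin a) (Fin a) ℝ :=
  (T : ℝ)⁻¹ • ∑ t, F t * (F t).transpose

/-- The column factor second-moment matrix `(1/T) ∑ F_t' F_t`. -/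
noncomputable def colMoment {T a b : ℕ} (F : Fin T → Matrix (Fin a) (Fin b) ℝ) :
    Matrix (Fin b) (Fin b) ℝ :=
  (T : ℝ)⁻¹ • ∑ t, (F t).transpose * F t

theorem rowMoment_isHermitian {T a b : ℕ} (F : Fin T → Matrix (Fin a) (Fin b) ℝ) :
    (rowMoment F).IsHermitian := by
  simp [Matrix.IsHermitian, rowMoment, Matrix.conjTranspose_eq_transpose_of_trivial,
    Matrix.transpose_smul, Matrix.transpose_sum, Matrix.transpose_mul]

theorem colMoment_isHermitian {T a b : ℕ} (F : Fin T → Matrix (Fin a) (Fin b) ℝ) :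
    (colMoment F).IsHermitian := by
  simp [Matrix.IsHermitian, colMoment, Matrix.conjTranspose_eq_transpose_of_trivial,
    Matrix.transpose_smul, Matrix.transpose_sum, Matrix.transpose_mul]

/-- The matrix is diagonal with non-increasing diagonal entries. -/
def IsDiagDecreasing {m : ℕ} (A : Matrix (Fin m) (Fin m) ℝ) : Prop :=
  A.IsDiag ∧ Antitone fun j => A j j

/-- The parameter space `Θ`: loadings and factors in the given sets, `R'R/p₁ = I`,
`C'C/p₂ = I`, and both factor second-moment matrices diagonal with non-increasing entries. -/
def paramSpace (p₁ p₂ T : ℕ) {a b : ℕ} (𝒜 : Set (Fin a → ℝ))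
    (ℱ : Set (Matrix (Fin a) (Fin b) ℝ)) (ℬ : Set (Fin b → ℝ)) :
    Set (FactorParam p₁ p₂ T a b) :=
  {θ | (∀ i, θ.R i ∈ 𝒜) ∧ (∀ t, θ.F t ∈ ℱ) ∧ (∀ j, θ.C j ∈ ℬ) ∧
    (p₁ : ℝ)⁻¹ • (θ.R.transpose * θ.R) = 1 ∧ (p₂ : ℝ)⁻¹ • (θ.C.transpose * θ.C) = 1 ∧
    IsDiagDecreasing (rowMoment θ.F) ∧ IsDiagDecreasing (colMoment θ.F)}

/-- The empirical check loss
`M(θ) = (p₁ p₂ T)⁻¹ ∑_{i,j,t} ρ_τ(X_{ijt} - r_i' F_t c_j)` at the data array `x`. -/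
noncomputable def empiricalLoss {p₁ p₂ T a b : ℕ} (τ : ℝ)
    (x : Fin p₁ × Fin p₂ × Fin T → ℝ) (θ : FactorParam p₁ p₂ T a b) : ℝ :=
  ((p₁ : ℝ) * p₂ * T)⁻¹ *
    ∑ i, ∑ j, ∑ t, checkLoss τ (x (i, j, t) - θ.common i j t)

/-- The `K₁ × K₂` matrix with `F` as upper left block and zeros elsewhere. -/
def padFactor {k₁ k₂ : ℕ} (K₁ K₂ : ℕ) (F : Matrix (Fin k₁) (Fin k₂) ℝ) :
    Matrix (Fin K₁) (Fin K₂) ℝ :=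
  fun a b => if h : a.val < k₁ ∧ b.val < k₂ then F ⟨a.val, h.1⟩ ⟨b.val, h.2⟩ else 0

/-- The first `k` columns of `R'` are those of `R`. -/
def ExtendsColumns {p k K : ℕ} (h : k ≤ K) (R : Matrix (Fin p) (Fin k) ℝ)
    (R' : Matrix (Fin p) (Fin K) ℝ) : Prop :=
  ∀ i a, R' i (Fin.castLE h a) = R i a

/-- The rate `L = min {√(p₁p₂), √(p₂T), √(p₁T)}`. -/
noncomputable def rateL (p₁ p₂ T : ℕ) : ℝ :=
  min (√((p₁ : ℝ) * p₂)) (min (√((p₂ : ℝ) * T)) (√((p₁ : ℝ) * T)))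

/-- The number of eigenvalues (with multiplicity) of a symmetric matrix that exceed `c`. -/
noncomputable def countEigenvaluesAbove {m : ℕ} {A : Matrix (Fin m) (Fin m) ℝ}
    (hA : A.IsHermitian) (c : ℝ) : ℕ :=
  Fintype.card {j : Fin m // c < hA.eigenvalues j}

/-- The rank-minimization estimator of the number of row factors. -/
noncomputable def rankEstRow {p₁ p₂ T a b : ℕ} (θ : FactorParam p₁ p₂ T a b) (c : ℝ) : ℕ :=
  countEigenvaluesAbove (rowMoment_isHermitian θ.F) c

/-- The rank-minimization estimator of the number of column factors. -/
noncomputable def rankEstCol {p₁ p₂ T a b : ℕ} (θ : FactorParam p₁ p₂ T a b) (c : ℝ) : ℕ :=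
  countEigenvaluesAbove (colMoment_isHermitian θ.F) c

/-- The idiosyncratic errors `ε_{ijt} = X_{ijt} - r_{0i}' F_{0t} c_{0j}`. -/
def idioError {p₁ p₂ T a b : ℕ} (x : Fin p₁ × Fin p₂ × Fin T → ℝ)
    (θ : FactorParam p₁ p₂ T a b) : Fin p₁ × Fin p₂ × Fin T → ℝ :=
  fun s => x s - θ.common s.1 s.2.1 s.2.2

/-- `g` is a probability density on `ℝ` whose distribution function at `0` equals `τ`. -/
def IsDensityWithZeroQuantile (τ : ℝ) (g : ℝ → ℝ) : Prop :=
  Measurable g ∧ (∀ u, 0 ≤ g u) ∧ ∫⁻ u, ENNReal.ofReal (g u) = 1 ∧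
    ∫⁻ u in Set.Iic 0, ENNReal.ofReal (g u) = ENNReal.ofReal τ

/-! The estimated common component is close to the true one in Frobenius norm, at rate `1 / L`. By
Weyl's inequality the moment eigenvalues then cannot cross a threshold that tends to zero more
slowly than `1 / L ^ 2`. Rate. Let `Δ` be the difference of the estimated and true common
components. Comparison with the zero-padded truth shows that the loss increment at `Δ` is at most
zero. The increment is convex in `Δ` and vanishes at `0`, so `Δ` can lie outside the sphere of
radius `r` only if some array on that sphere has small empirical increment
(`sum_sq_le_of_notMem_badErrors`). On the sphere the expected increment is at least `c / 2 * r ^ 2`,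
because zero is the `τ`-quantile and the density is bounded below
(`IsDensityWithZeroQuantile.le_integral_lossIncr`). The centred increments are controlled uniformly
by symmetrization and contraction (`integral_sup'_centred_le`), which leave a Rademacher process
indexed by arrays of bounded mode ranks. By duality with the spectral norm and a net argument its
expected supremum is of order `r * √(p₁ + p₂ + T)` (`sum_signs_sup'_modeRank_le`). Markov's
inequality makes the bad event as unlikely as desired when `r = A * √(p₁ + p₂ + T)` with `A` large.
The normalized squared error is then at most `3 * A ^ 2 / L ^ 2`, eventually below the threshold,
with no restriction on relative rates since `(p₁ + p₂ + T) / (p₁ p₂ T)` is a sum of three terms each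
at most `1 / L ^ 2`. Counting. Under the normalization the diagonal entries of `rowMoment` are
scaled squared singular values of the mode-one unfolding, so their square roots move by at most the
root mean square error (`sqrt_rowMoment_le`). Spurious entries stay below the threshold; the genuine
ones stay near their positive limits (`rankEstRow_eq`). Column factors follow by transposition. -/

/-! ### Rademacher sums: contraction and maximal inequality -/

/-- The value `±1` of a sign as a real number. -/
def signVal (e : ℤˣ) : ℝ := ((e : ℤ) : ℝ)

theorem signVal_one : signVal 1 = 1 := by simp [signVal]

theorem signVal_neg_one : signVal (-1) = -1 := by simp [signVal]

theorem signVal_mul_neg_one (e : ℤˣ) : signVal (e * -1) = -signVal e := by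
  simp [signVal]

/-- This is contraction for a single sign. If `i` and `j` attain the two suprema on the left, the
left side is `a i + a j + (y i - y j) ≤ a i + a j + |x i - x j|`. Either sign of `x i - x j` is
covered on the right by assigning `i` and `j` to the two suprema in the suitable order. -/
theorem sup'_add_sup'_sub_le {ι : Type*} (D : Finset ι) (hD : D.Nonempty) (a x y : ι → ℝ)
    (h : ∀ i j, |y i - y j| ≤ |x i - x j|) :
    D.sup' hD (fun i => a i + y i) + D.sup' hD (fun i => a i - y i) ≤
      D.sup' hD (fun i => a i + x i) + D.sup' hD (fun i => a i - x i) := by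
  obtain ⟨i, hi, hi'⟩ := D.exists_mem_eq_sup' hD (fun i => a i + y i)
  obtain ⟨j, hj, hj'⟩ := D.exists_mem_eq_sup' hD (fun i => a i - y i)
  rw [hi', hj']
  have h1 := D.le_sup' (fun i => a i + x i) hi
  have h2 := D.le_sup' (fun i => a i - x i) hi
  have h3 := D.le_sup' (fun i => a i + x i) hj
  have h4 := D.le_sup' (fun i => a i - x i) hj
  have h5 := (le_abs_self _).trans (h i j)
  rcases abs_cases (x i - x j) with ⟨h6, _⟩ | ⟨h6, _⟩ <;> linarith

section Contraction

variable {S : Type*} [Fintype S] [DecidableEq S]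

theorem sum_signs_flip (s₀ : S) (H : (S → ℤˣ) → ℝ) :
    2 * ∑ ξ, H ξ = ∑ ξ, (H ξ + H (ξ * Pi.mulSingle s₀ (-1))) := by
  have := Equiv.sum_comp (Equiv.mulRight (Pi.mulSingle s₀ (-1 : ℤˣ) : S → ℤˣ)) H
  simp only [Equiv.coe_mulRight] at this
  rw [Finset.sum_add_distrib, this, two_mul]

theorem sum_signVal_split (s₀ : S) (ξ : S → ℤˣ) (z : S → ℝ) :
    ∑ s, signVal (ξ s) * z s =
      ∑ s ∈ Finset.univ.erase s₀, signVal (ξ s) * z s + signVal (ξ s₀) * z s₀ :=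
  (Finset.sum_erase_add _ _ (Finset.mem_univ s₀)).symm

/-- **Ledoux–Talagrand contraction principle** for finitely many Rademacher sums. -/
theorem sum_signs_sup'_le_of_contraction {ι : Type*} (D : Finset ι) (hD : D.Nonempty)
    (x y : S → ι → ℝ) (h : ∀ s i j, |y s i - y s j| ≤ |x s i - x s j|) :
    ∑ ξ : S → ℤˣ, D.sup' hD (fun i => ∑ s, signVal (ξ s) * y s i) ≤
      ∑ ξ : S → ℤˣ, D.sup' hD (fun i => ∑ s, signVal (ξ s) * x s i) := by
  -- Replace `x s` by `y s` one index at a time. Pairing each `ξ` with its flip at the new index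
  -- `s₀` leaves all other terms fixed, so each exchange is the single-sign case.
  suffices H : ∀ A : Finset S,
      ∑ ξ : S → ℤˣ, D.sup' hD
          (fun i => ∑ s, signVal (ξ s) * (if s ∈ A then y s i else x s i)) ≤
        ∑ ξ : S → ℤˣ, D.sup' hD (fun i => ∑ s, signVal (ξ s) * x s i) by
    simpa using H Finset.univ
  intro A
  induction A using Finset.induction_on with
  | empty => simp
  | insert s₀ A hs₀ ih =>
    refine le_trans ?_ ih
    refine le_of_mul_le_mul_left ?_ (zero_lt_two (α := ℝ))
    rw [sum_signs_flip s₀, sum_signs_flip s₀]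
    refine Finset.sum_le_sum fun ξ _ => ?_
    have key : ∀ (z : S → ι → ℝ) (B : Finset S) (_ : ∀ s ∈ Finset.univ.erase s₀, (s ∈ B ↔ s ∈ A))
        (_ : ∀ i, (if s₀ ∈ B then y s₀ i else x s₀ i) = z s₀ i),
        D.sup' hD (fun i => ∑ s, signVal (ξ s) * (if s ∈ B then y s i else x s i)) +
          D.sup' hD (fun i => ∑ s, signVal ((ξ * (Pi.mulSingle s₀ (-1) : S → ℤˣ)) s) *
            (if s ∈ B then y s i else x s i)) =
        D.sup' hD (fun i => ∑ s ∈ Finset.univ.erase s₀,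
            signVal (ξ s) * (if s ∈ A then y s i else x s i) + signVal (ξ s₀) * z s₀ i) +
          D.sup' hD (fun i => ∑ s ∈ Finset.univ.erase s₀,
            signVal (ξ s) * (if s ∈ A then y s i else x s i) - signVal (ξ s₀) * z s₀ i) := by
      intro z B hB hz
      have hsum : ∀ i, ∑ s ∈ Finset.univ.erase s₀,
            signVal (ξ s) * (if s ∈ B then y s i else x s i) = ∑ s ∈ Finset.univ.erase s₀,
            signVal (ξ s) * (if s ∈ A then y s i else x s i) := fun i =>
        Finset.sum_congr rfl fun s hs => by simp only [hB s hs]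
      have hsum' : ∀ i, ∑ s ∈ Finset.univ.erase s₀, signVal ((ξ * (Pi.mulSingle s₀ (-1) : S → ℤˣ)) s) *
            (if s ∈ B then y s i else x s i) = ∑ s ∈ Finset.univ.erase s₀,
            signVal (ξ s) * (if s ∈ A then y s i else x s i) := fun i =>
        Finset.sum_congr rfl fun s hs => by
          rw [Pi.mul_apply, Pi.mulSingle_eq_of_ne (Finset.ne_of_mem_erase hs), mul_one]
          simp only [hB s hs]
      congr 1
      · congr 1
        funext i
        rw [sum_signVal_split s₀, hsum, hz]
      · congr 1
        funext i
        rw [sum_signVal_split s₀, hsum', hz, Pi.mul_apply, Pi.mulSingle_eq_same,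
          signVal_mul_neg_one]
        ring
    rw [key y (insert s₀ A) (fun s hs => by simp [Finset.ne_of_mem_erase hs]) (by simp),
      key x A (fun s _ => Iff.rfl) (by simp [hs₀])]
    refine sup'_add_sup'_sub_le D hD _ _ _ fun i j => ?_
    rw [← mul_sub, ← mul_sub, abs_mul, abs_mul]
    exact mul_le_mul_of_nonneg_left (h s₀ i j) (abs_nonneg _)

theorem sum_units_exp (a : ℝ) : ∑ e : ℤˣ, Real.exp (signVal e * a) = 2 * Real.cosh a := by
  rw [show (Finset.univ : Finset ℤˣ) = {1, -1} from rfl, Finset.sum_pair (by decide),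
    signVal_one, signVal_neg_one, Real.cosh_eq]
  ring_nf

theorem card_signs : (Fintype.card (S → ℤˣ) : ℝ) = 2 ^ Fintype.card S := by
  simp [Fintype.card_units_int]

/-- The moment generating function of a Rademacher sum is sub-Gaussian. -/
theorem sum_signs_exp_le (a : S → ℝ) :
    ∑ ξ : S → ℤˣ, Real.exp (∑ s, signVal (ξ s) * a s) ≤
      2 ^ Fintype.card S * Real.exp ((∑ s, a s ^ 2) / 2) := by
  have h1 : ∑ ξ : S → ℤˣ, Real.exp (∑ s, signVal (ξ s) * a s) =
      ∏ s, ∑ e : ℤˣ, Real.exp (signVal e * a s) := by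
    rw [Fintype.prod_sum]
    simp [Real.exp_sum]
  rw [h1, Finset.sum_div, Real.exp_sum, ← Finset.card_univ, ← Finset.prod_const,
    ← Finset.prod_mul_distrib]
  refine Finset.prod_le_prod (fun s _ => Finset.sum_nonneg fun e _ => (Real.exp_pos _).le)
    fun s _ => ?_
  rw [sum_units_exp]
  exact mul_le_mul_of_nonneg_left (Real.cosh_le_exp_half_sq _) zero_le_two

/-- Maximal inequality for finitely many Rademacher sums. -/
theorem sum_signs_sup'_le {ι : Type*} (D : Finset ι) (hD : D.Nonempty) (a : ι → S → ℝ)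
    (ha : ∀ i ∈ D, ∑ s, a i s ^ 2 ≤ 1) {l : ℝ} (hl : 0 < l) :
    ∑ ξ : S → ℤˣ, D.sup' hD (fun i => ∑ s, signVal (ξ s) * a i s) ≤
      2 ^ Fintype.card S * ((Real.log D.card + l ^ 2 / 2 + 1) / l) := by
  -- With this `b` the average over signs of `∑ i ∈ D, exp (l * Z i - b)` is at most `1`, where `Z
  -- i` is the Rademacher sum. The tangent bound `t ≤ b + exp (t - b)` then replaces Jensen's
  -- inequality for the logarithm.
  set b : ℝ := Real.log D.card + l ^ 2 / 2 with hb
  have hcard : (0 : ℝ) < D.card := by exact_mod_cast hD.card_pos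
  have h1 : ∀ ξ : S → ℤˣ, D.sup' hD (fun i => ∑ s, signVal (ξ s) * a i s) ≤
      (b + ∑ i ∈ D, Real.exp (-b) * Real.exp (∑ s, signVal (ξ s) * (l * a i s))) / l := by
    intro ξ
    refine Finset.sup'_le _ _ fun i hi => ?_
    rw [le_div_iff₀ hl]
    have h2 : Real.exp (-b) * Real.exp (∑ s, signVal (ξ s) * (l * a i s)) ≤
        ∑ i ∈ D, Real.exp (-b) * Real.exp (∑ s, signVal (ξ s) * (l * a i s)) :=
      Finset.single_le_sum (f := fun i =>
        Real.exp (-b) * Real.exp (∑ s, signVal (ξ s) * (l * a i s)))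
        (fun _ _ => by positivity) hi
    rw [← Real.exp_add] at h2
    have h3 := Real.add_one_le_exp (-b + ∑ s, signVal (ξ s) * (l * a i s))
    have h4 : (∑ s, signVal (ξ s) * a i s) * l = ∑ s, signVal (ξ s) * (l * a i s) := by
      rw [Finset.sum_mul]
      exact Finset.sum_congr rfl fun s _ => by ring
    linarith
  refine (Finset.sum_le_sum fun ξ _ => h1 ξ).trans ?_
  rw [← Finset.sum_div, Finset.sum_add_distrib, Finset.sum_const, Finset.card_univ, nsmul_eq_mul,
    card_signs, Finset.sum_comm, ← mul_div_assoc]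
  refine div_le_div_of_nonneg_right ?_ hl.le
  rw [mul_add _ b 1]
  refine add_le_add le_rfl ?_
  have h5 : ∀ i ∈ D, ∑ ξ : S → ℤˣ, Real.exp (-b) * Real.exp (∑ s, signVal (ξ s) * (l * a i s)) ≤
      Real.exp (-b) * (2 ^ Fintype.card S * Real.exp (l ^ 2 / 2)) := by
    intro i hi
    rw [← Finset.mul_sum]
    refine mul_le_mul_of_nonneg_left ((sum_signs_exp_le _).trans ?_) (Real.exp_pos _).le
    refine mul_le_mul_of_nonneg_left (Real.exp_le_exp.2 ?_) (by positivity)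
    have : ∑ s, (l * a i s) ^ 2 = l ^ 2 * ∑ s, a i s ^ 2 := by
      rw [Finset.mul_sum]
      exact Finset.sum_congr rfl fun s _ => by ring
    rw [this]
    have := mul_le_mul_of_nonneg_left (ha i hi) (sq_nonneg l)
    linarith
  refine (Finset.sum_le_sum h5).trans (le_of_eq ?_)
  rw [Finset.sum_const, nsmul_eq_mul, hb, neg_add, Real.exp_add, Real.exp_neg (Real.log _),
    Real.exp_log hcard]
  have : Real.exp (-(l ^ 2 / 2)) * Real.exp (l ^ 2 / 2) = 1 := by
    rw [← Real.exp_add, neg_add_cancel, Real.exp_zero]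
  field_simp
  linear_combination this

end Contraction

/-! ### Nets of Euclidean balls and the spectral norm of a three-way array -/

section Net

/-- A `1/2`-net of the Euclidean unit ball with at most `5 ^ n` points. -/
theorem exists_half_net (n : ℕ) : ∃ N : Finset (EuclideanSpace ℝ (Fin n)), N.Nonempty ∧
    N.card ≤ 5 ^ n ∧ (∀ x ∈ N, ‖x‖ ≤ 1) ∧
    ∀ x : EuclideanSpace ℝ (Fin n), ‖x‖ ≤ 1 → ∃ y ∈ N, ‖x - y‖ ≤ 1 / 2 := by
  classical
  -- A `1/2`-separated subset of the ball with the most points is a net. Doubling makes it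
  -- `1`-separated in the ball of radius `2`, where the Besicovitch packing bound gives `5 ^ n`.
  let Q : Finset (EuclideanSpace ℝ (Fin n)) → Prop := fun s =>
    (∀ x ∈ s, ‖x‖ ≤ 1) ∧ ∀ x ∈ s, ∀ y ∈ s, x ≠ y → 1 / 2 ≤ ‖x - y‖
  have hcard : ∀ s, Q s → s.card ≤ 5 ^ n := by
    intro s hs
    have hinj : Function.Injective fun x : EuclideanSpace ℝ (Fin n) => (2 : ℝ) • x :=
      smul_right_injective _ two_ne_zero
    have := Besicovitch.card_le_of_separated (s.image fun x => (2 : ℝ) • x) ?_ ?_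
    · rwa [Finset.card_image_of_injective _ hinj, finrank_euclideanSpace_fin] at this
    · intro c hc
      obtain ⟨x, hx, rfl⟩ := Finset.mem_image.1 hc
      rw [norm_smul, Real.norm_two]
      linarith [hs.1 x hx]
    · intro c hc d hd hcd
      obtain ⟨x, hx, rfl⟩ := Finset.mem_image.1 hc
      obtain ⟨y, hy, rfl⟩ := Finset.mem_image.1 hd
      rw [← smul_sub, norm_smul, Real.norm_two]
      linarith [hs.2 x hx y hy fun h => hcd (by rw [h])]
  let R : ℕ → Prop := fun m => ∃ s, Q s ∧ s.card = m
  have hR0 : R 0 := ⟨∅, ⟨by simp, by simp⟩, rfl⟩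
  obtain ⟨s, hs, hsc⟩ : R (Nat.findGreatest R (5 ^ n)) := Nat.findGreatest_spec (Nat.zero_le _) hR0
  have hnet : ∀ x : EuclideanSpace ℝ (Fin n), ‖x‖ ≤ 1 → ∃ y ∈ s, ‖x - y‖ ≤ 1 / 2 := by
    intro x hx
    by_contra! hcon
    have hxs : x ∉ s := fun h => by
      have := hcon x h
      norm_num at this
    have hQ : Q (insert x s) := by
      refine ⟨fun y hy => ?_, fun y hy z hz hyz => ?_⟩
      · rcases Finset.mem_insert.1 hy with rfl | hy
        exacts [hx, hs.1 y hy]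
      · rcases Finset.mem_insert.1 hy with rfl | hy' <;>
          rcases Finset.mem_insert.1 hz with rfl | hz'
        · exact absurd rfl hyz
        · exact (hcon z hz').le
        · rw [norm_sub_rev]
          exact (hcon y hy').le
        · exact hs.2 y hy' z hz' hyz
    have h1 : (insert x s).card ≤ Nat.findGreatest R (5 ^ n) :=
      Nat.le_findGreatest (hcard _ hQ) ⟨_, hQ, rfl⟩
    rw [Finset.card_insert_of_notMem hxs] at h1
    omega
  refine ⟨s, ?_, hcard s hs, hs.1, hnet⟩
  obtain ⟨y, hy, -⟩ := hnet 0 (by simp)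
  exact ⟨y, hy⟩

theorem euclidean_inner_eq_sum {n : ℕ} (g : Fin n → ℝ) (x : EuclideanSpace ℝ (Fin n)) :
    inner ℝ (WithLp.toLp 2 g) x = ∑ i, g i * x i := by
  simp [PiLp.inner_apply, mul_comm]

/-- A linear functional bounded on a `1/2`-net is bounded on the whole space. -/
theorem sum_mul_le_of_net {n : ℕ} {N : Finset (EuclideanSpace ℝ (Fin n))} (hN : N.Nonempty)
    (hnet : ∀ x : EuclideanSpace ℝ (Fin n), ‖x‖ ≤ 1 → ∃ y ∈ N, ‖x - y‖ ≤ 1 / 2)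
    (g : Fin n → ℝ) {c : ℝ} (hc : ∀ y ∈ N, ∑ i, g i * y i ≤ c) (x : EuclideanSpace ℝ (Fin n)) :
    ∑ i, g i * x i ≤ 2 * c * ‖x‖ := by
  set G : EuclideanSpace ℝ (Fin n) := WithLp.toLp 2 g with hG
  simp only [← euclidean_inner_eq_sum, ← hG] at hc ⊢
  -- A net point `y` within `1/2` of the direction of `G` gives `‖G‖ ≤ ⟪G, y⟫ + ‖G‖ / 2`. For `G =
  -- 0`, a point of the net is still needed to see that `0 ≤ c`.
  have hm : ‖G‖ ≤ 2 * c := by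
    rcases eq_or_ne G 0 with h | h
    · obtain ⟨y, hy⟩ := hN
      have := hc y hy
      rw [h, inner_zero_left] at this
      rw [h, norm_zero]
      linarith
    · have hpos : 0 < ‖G‖ := norm_pos_iff.2 h
      obtain ⟨y, hy, hxy⟩ := hnet (‖G‖⁻¹ • G) (by
        rw [norm_smul, norm_inv, norm_norm, inv_mul_cancel₀ hpos.ne'])
      have h1 : inner ℝ G (‖G‖⁻¹ • G) = ‖G‖ := by
        rw [inner_smul_right, real_inner_self_eq_norm_sq]
        field_simp
      have h2 : inner ℝ G (‖G‖⁻¹ • G - y) ≤ ‖G‖ * (1 / 2) :=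
        (real_inner_le_norm _ _).trans (mul_le_mul_of_nonneg_left hxy hpos.le)
      rw [inner_sub_right, h1] at h2
      linarith [hc y hy]
  exact (real_inner_le_norm _ _).trans (mul_le_mul_of_nonneg_right hm (norm_nonneg _))

/-- The trilinear form of a three-way array. -/
def trilinear {p₁ p₂ T : ℕ} (ξ : Fin p₁ × Fin p₂ × Fin T → ℝ) (u : Fin p₁ → ℝ) (v : Fin p₂ → ℝ)
    (w : Fin T → ℝ) : ℝ :=
  ∑ s, ξ s * (u s.1 * v s.2.1 * w s.2.2)

variable {p₁ p₂ T : ℕ}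

theorem trilinear_eq_sum₁ (ξ : Fin p₁ × Fin p₂ × Fin T → ℝ) (u : Fin p₁ → ℝ) (v : Fin p₂ → ℝ)
    (w : Fin T → ℝ) :
    trilinear ξ u v w = ∑ i, (∑ j, ∑ t, ξ (i, j, t) * (v j * w t)) * u i := by
  simp only [trilinear, Fintype.sum_prod_type, Finset.sum_mul]
  exact Finset.sum_congr rfl fun i _ => Finset.sum_congr rfl fun j _ =>
    Finset.sum_congr rfl fun t _ => by ring

theorem trilinear_eq_sum₂ (ξ : Fin p₁ × Fin p₂ × Fin T → ℝ) (u : Fin p₁ → ℝ) (v : Fin p₂ → ℝ)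
    (w : Fin T → ℝ) :
    trilinear ξ u v w = ∑ j, (∑ i, ∑ t, ξ (i, j, t) * (u i * w t)) * v j := by
  simp only [trilinear, Fintype.sum_prod_type, Finset.sum_mul]
  rw [Finset.sum_comm]
  exact Finset.sum_congr rfl fun i _ => Finset.sum_congr rfl fun j _ =>
    Finset.sum_congr rfl fun t _ => by ring

theorem trilinear_eq_sum₃ (ξ : Fin p₁ × Fin p₂ × Fin T → ℝ) (u : Fin p₁ → ℝ) (v : Fin p₂ → ℝ)
    (w : Fin T → ℝ) :
    trilinear ξ u v w = ∑ t, (∑ i, ∑ j, ξ (i, j, t) * (u i * v j)) * w t := by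
  simp only [trilinear, Fintype.sum_prod_type, Finset.sum_mul]
  have : ∀ i : Fin p₁, ∑ j : Fin p₂, ∑ t : Fin T, ξ (i, j, t) * (u i * v j * w t) =
      ∑ t : Fin T, ∑ j : Fin p₂, ξ (i, j, t) * (u i * v j * w t) := fun i => Finset.sum_comm
  simp only [this]
  rw [Finset.sum_comm]
  exact Finset.sum_congr rfl fun i _ => Finset.sum_congr rfl fun j _ =>
    Finset.sum_congr rfl fun t _ => by ring

/-- The spectral norm of a three-way array is controlled by its values on nets. -/
theorem trilinear_le_of_net {N₁ : Finset (EuclideanSpace ℝ (Fin p₁))}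
    {N₂ : Finset (EuclideanSpace ℝ (Fin p₂))} {N₃ : Finset (EuclideanSpace ℝ (Fin T))}
    (hN₁ : N₁.Nonempty) (hN₂ : N₂.Nonempty) (hN₃ : N₃.Nonempty)
    (hnet₁ : ∀ x : EuclideanSpace ℝ (Fin p₁), ‖x‖ ≤ 1 → ∃ y ∈ N₁, ‖x - y‖ ≤ 1 / 2)
    (hnet₂ : ∀ x : EuclideanSpace ℝ (Fin p₂), ‖x‖ ≤ 1 → ∃ y ∈ N₂, ‖x - y‖ ≤ 1 / 2)
    (hnet₃ : ∀ x : EuclideanSpace ℝ (Fin T), ‖x‖ ≤ 1 → ∃ y ∈ N₃, ‖x - y‖ ≤ 1 / 2)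
    (ξ : Fin p₁ × Fin p₂ × Fin T → ℝ) {c : ℝ}
    (hc : ∀ u ∈ N₁, ∀ v ∈ N₂, ∀ w ∈ N₃, trilinear ξ u v w ≤ c)
    (u : EuclideanSpace ℝ (Fin p₁)) (v : EuclideanSpace ℝ (Fin p₂))
    (w : EuclideanSpace ℝ (Fin T)) :
    trilinear ξ u v w ≤ 8 * c * ‖u‖ * ‖v‖ * ‖w‖ := by
  have h1 : ∀ v ∈ N₂, ∀ w ∈ N₃, trilinear ξ u v w ≤ 2 * c * ‖u‖ := fun v hv w hw => by
    rw [trilinear_eq_sum₁]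
    exact sum_mul_le_of_net hN₁ hnet₁ _
      (fun y hy => by rw [← trilinear_eq_sum₁]; exact hc y hy v hv w hw) u
  have h2 : ∀ w ∈ N₃, trilinear ξ u v w ≤ 2 * (2 * c * ‖u‖) * ‖v‖ := fun w hw => by
    rw [trilinear_eq_sum₂]
    exact sum_mul_le_of_net hN₂ hnet₂ _
      (fun y hy => by rw [← trilinear_eq_sum₂]; exact h1 y hy w hw) v
  have h3 : trilinear ξ u v w ≤ 2 * (2 * (2 * c * ‖u‖) * ‖v‖) * ‖w‖ := by
    rw [trilinear_eq_sum₃]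
    exact sum_mul_le_of_net hN₃ hnet₃ _
      (fun y hy => by rw [← trilinear_eq_sum₃]; exact h2 y hy) w
  linarith

end Net

/-! ### Duality between spectral norm and bounded mode ranks -/

section LowRank

variable {p₁ p₂ T : ℕ}

/-- A three-way array whose mode-one and mode-two fibres span spaces of dimension at most
`κ₁` and `κ₂`. -/
def HasModeRankLE (κ₁ κ₂ : ℕ) (Δ : Fin p₁ × Fin p₂ × Fin T → ℝ) : Prop :=
  (∃ W : Submodule ℝ (EuclideanSpace ℝ (Fin p₁)), Module.finrank ℝ W ≤ κ₁ ∧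
    ∀ j t, WithLp.toLp 2 (fun i => Δ (i, j, t)) ∈ W) ∧
  ∃ W : Submodule ℝ (EuclideanSpace ℝ (Fin p₂)), Module.finrank ℝ W ≤ κ₂ ∧
    ∀ i t, WithLp.toLp 2 (fun j => Δ (i, j, t)) ∈ W

theorem HasModeRankLE.smul {κ₁ κ₂ : ℕ} {Δ : Fin p₁ × Fin p₂ × Fin T → ℝ}
    (h : HasModeRankLE κ₁ κ₂ Δ) (c : ℝ) : HasModeRankLE κ₁ κ₂ (fun s => c * Δ s) := by
  obtain ⟨⟨W₁, h₁, h₁'⟩, W₂, h₂, h₂'⟩ := h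
  exact ⟨⟨W₁, h₁, fun j t => W₁.smul_mem c (h₁' j t)⟩, W₂, h₂, fun i t => W₂.smul_mem c (h₂' i t)⟩

theorem hasModeRankLE_zero (κ₁ κ₂ : ℕ) :
    HasModeRankLE κ₁ κ₂ (0 : Fin p₁ × Fin p₂ × Fin T → ℝ) :=
  ⟨⟨⊥, by simp, fun _ _ => (⊥ : Submodule ℝ _).zero_mem⟩,
    ⊥, by simp, fun _ _ => (⊥ : Submodule ℝ _).zero_mem⟩

/-- Every subspace has a finite family of unit vectors reproducing its elements. -/
theorem exists_reproducing_family {n : ℕ} (W : Submodule ℝ (EuclideanSpace ℝ (Fin n))) :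
    ∃ e : Fin (Module.finrank ℝ W) → EuclideanSpace ℝ (Fin n), (∀ a, ‖e a‖ = 1) ∧
      ∀ y ∈ W, ∀ i, y i = ∑ a, e a i * ∑ k, e a k * y k := by
  let b := stdOrthonormalBasis ℝ W
  refine ⟨fun a => (b a : EuclideanSpace ℝ (Fin n)), fun a => ?_, fun y hy i => ?_⟩
  · rw [Submodule.norm_coe, b.norm_eq_one]
  · have h := congrArg (fun z : W => (z : EuclideanSpace ℝ (Fin n)) i) (b.sum_repr' ⟨y, hy⟩)
    simp only [Submodule.coe_sum, Submodule.coe_smul, Submodule.coe_inner] at h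
    rw [← h, WithLp.ofLp_sum, Finset.sum_apply]
    refine Finset.sum_congr rfl fun a _ => ?_
    rw [WithLp.ofLp_smul, Pi.smul_apply, smul_eq_mul, mul_comm, ← euclidean_inner_eq_sum]

theorem sq_sum_mul_le_of_norm_eq_one {n : ℕ} {e : EuclideanSpace ℝ (Fin n)} (he : ‖e‖ = 1)
    (y : Fin n → ℝ) : (∑ k, e k * y k) ^ 2 ≤ ∑ k, y k ^ 2 := by
  have h := Finset.sum_mul_sq_le_sq_mul_sq Finset.univ (fun k => e k) y
  have h2 : ∑ k, e k ^ 2 = 1 := by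
    rw [← EuclideanSpace.real_norm_sq_eq, he, one_pow]
  rwa [h2, one_mul] at h

/-- Duality between the spectral norm and arrays of bounded mode ranks. -/
theorem HasModeRankLE.sum_mul_le {κ₁ κ₂ : ℕ} {Δ : Fin p₁ × Fin p₂ × Fin T → ℝ}
    (h : HasModeRankLE κ₁ κ₂ Δ) {ξ : Fin p₁ × Fin p₂ × Fin T → ℝ} {c : ℝ} (hc0 : 0 ≤ c)
    (hc : ∀ (u : EuclideanSpace ℝ (Fin p₁)) (v : EuclideanSpace ℝ (Fin p₂))
      (w : EuclideanSpace ℝ (Fin T)), trilinear ξ u v w ≤ c * ‖u‖ * ‖v‖ * ‖w‖)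
    {r : ℝ} (hr : 0 ≤ r) (hΔ : ∑ s, Δ s ^ 2 ≤ r ^ 2) :
    ∑ s, ξ s * Δ s ≤ κ₁ * κ₂ * (c * r) := by
  obtain ⟨⟨W₁, hW₁, hmem₁⟩, W₂, hW₂, hmem₂⟩ := h
  obtain ⟨e, he, hrep₁⟩ := exists_reproducing_family W₁
  obtain ⟨f, hf, hrep₂⟩ := exists_reproducing_family W₂
  -- Tucker decomposition `Δ = ∑ e a ⊗ f b ⊗ g a b` with orthonormal bases of the two fibre spaces.
  -- The third mode is unrestricted, so `g a b` carries the size: contracting with unit vectors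
  -- keeps its norm at most `r`. At most `κ₁ * κ₂` rank-one terms remain.
  let H : Fin (Module.finrank ℝ W₁) → Fin p₂ → Fin T → ℝ := fun a j t => ∑ i, e a i * Δ (i, j, t)
  let g : Fin (Module.finrank ℝ W₁) → Fin (Module.finrank ℝ W₂) → Fin T → ℝ :=
    fun a b t => ∑ j, f b j * H a j t
  have hH : ∀ a t, WithLp.toLp 2 (fun j => H a j t) ∈ W₂ := by
    intro a t
    have : WithLp.toLp 2 (fun j => H a j t) =
        ∑ i, e a i • WithLp.toLp 2 (fun j => Δ (i, j, t)) := by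
      ext j
      simp [H, WithLp.ofLp_sum]
    rw [this]
    exact W₂.sum_mem fun i _ => W₂.smul_mem _ (hmem₂ i t)
  have hdec : ∀ s, Δ s = ∑ a, ∑ b, e a s.1 * f b s.2.1 * g a b s.2.2 := by
    rintro ⟨i, j, t⟩
    have h1 := hrep₁ _ (hmem₁ j t) i
    simp only at h1
    rw [h1]
    refine Finset.sum_congr rfl fun a _ => ?_
    have h2 := hrep₂ _ (hH a t) j
    simp only [H] at h2
    rw [h2, Finset.mul_sum]
    exact Finset.sum_congr rfl fun b _ => by simp only [g, H]; ring
  have hg : ∀ a b, ‖(WithLp.toLp 2 (g a b) : EuclideanSpace ℝ (Fin T))‖ ≤ r := by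
    intro a b
    refine le_of_sq_le_sq ?_ hr
    refine le_trans ?_ hΔ
    rw [EuclideanSpace.real_norm_sq_eq]
    calc ∑ t, g a b t ^ 2 ≤ ∑ t, ∑ j, H a j t ^ 2 :=
          Finset.sum_le_sum fun t _ => sq_sum_mul_le_of_norm_eq_one (hf b) _
      _ ≤ ∑ t, ∑ j, ∑ i, Δ (i, j, t) ^ 2 :=
          Finset.sum_le_sum fun t _ => Finset.sum_le_sum fun j _ =>
            sq_sum_mul_le_of_norm_eq_one (he a) _
      _ = ∑ s, Δ s ^ 2 := by
          simp only [Fintype.sum_prod_type]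
          rw [Finset.sum_comm]
          simp only [fun j => Finset.sum_comm (s := (Finset.univ : Finset (Fin T)))
            (t := (Finset.univ : Finset (Fin p₁))) (f := fun t i => Δ (i, j, t) ^ 2)]
          rw [Finset.sum_comm]
  have hsum : ∑ s, ξ s * Δ s = ∑ a, ∑ b, trilinear ξ (e a) (f b) (g a b) := by
    simp only [trilinear]
    rw [Finset.sum_congr rfl fun a _ => Finset.sum_comm, Finset.sum_comm]
    refine Finset.sum_congr rfl fun s _ => ?_
    rw [hdec s, Finset.mul_sum]
    exact Finset.sum_congr rfl fun a _ => by rw [Finset.mul_sum]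
  rw [hsum]
  have hab : ∀ a b, trilinear ξ (e a) (f b) (g a b) ≤ c * r := fun a b => by
    have := hc (e a) (f b) (WithLp.toLp 2 (g a b))
    rw [he, hf, mul_one, mul_one] at this
    exact this.trans (mul_le_mul_of_nonneg_left (hg a b) hc0)
  have hcr : 0 ≤ c * r := mul_nonneg hc0 hr
  calc ∑ a, ∑ b, trilinear ξ (e a) (f b) (g a b)
      ≤ ∑ _a : Fin (Module.finrank ℝ W₁), ∑ _b : Fin (Module.finrank ℝ W₂), c * r :=
        Finset.sum_le_sum fun a _ => Finset.sum_le_sum fun b _ => hab a b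
    _ = (Module.finrank ℝ W₁ : ℝ) * (Module.finrank ℝ W₂) * (c * r) := by
        simp [mul_assoc]
    _ ≤ κ₁ * κ₂ * (c * r) := by
        refine mul_le_mul_of_nonneg_right ?_ hcr
        exact mul_le_mul (by exact_mod_cast hW₁) (by exact_mod_cast hW₂) (by positivity)
          (by positivity)

/-- Expected supremum of a Rademacher process over arrays of bounded mode ranks. -/
theorem sum_signs_sup'_modeRank_le {ι : Type*} (D : Finset ι) (hD : D.Nonempty) {κ₁ κ₂ : ℕ}
    (Δ : ι → Fin p₁ × Fin p₂ × Fin T → ℝ) (hrank : ∀ i ∈ D, HasModeRankLE κ₁ κ₂ (Δ i))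
    {r : ℝ} (hr : 0 ≤ r) (hΔ : ∀ i ∈ D, ∑ s, Δ i s ^ 2 ≤ r ^ 2) (hdim : 0 < p₁ + p₂ + T) :
    ∑ ξ : Fin p₁ × Fin p₂ × Fin T → ℤˣ,
        D.sup' hD (fun i => ∑ s, signVal (ξ s) * Δ i s) ≤
      2 ^ Fintype.card (Fin p₁ × Fin p₂ × Fin T) *
        (28 * (κ₁ * κ₂) * r * √((p₁ + p₂ + T : ℕ) : ℝ)) := by
  obtain ⟨N₁, hN₁, hcard₁, hle₁, hnet₁⟩ := exists_half_net p₁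
  obtain ⟨N₂, hN₂, hcard₂, hle₂, hnet₂⟩ := exists_half_net p₂
  obtain ⟨N₃, hN₃, hcard₃, hle₃, hnet₃⟩ := exists_half_net T
  set E := N₁ ×ˢ N₂ ×ˢ N₃ with hE
  have hEne : E.Nonempty := hN₁.product (hN₂.product hN₃)
  have hEcard : (E.card : ℝ) ≤ 5 ^ (p₁ + p₂ + T) := by
    have : E.card ≤ 5 ^ p₁ * (5 ^ p₂ * 5 ^ T) := by
      rw [hE, Finset.card_product, Finset.card_product]
      exact Nat.mul_le_mul hcard₁ (Nat.mul_le_mul hcard₂ hcard₃)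
    rw [pow_add, pow_add, mul_assoc]
    exact_mod_cast this
  set a : EuclideanSpace ℝ (Fin p₁) × EuclideanSpace ℝ (Fin p₂) × EuclideanSpace ℝ (Fin T) →
    Fin p₁ × Fin p₂ × Fin T → ℝ := fun x s => x.1 s.1 * x.2.1 s.2.1 * x.2.2 s.2.2 with ha
  have hasq : ∀ x ∈ E, ∑ s, a x s ^ 2 ≤ 1 := by
    rintro ⟨u, v, w⟩ hx
    simp only [hE, Finset.mem_product] at hx
    have : ∑ s, a (u, v, w) s ^ 2 = ‖u‖ ^ 2 * ‖v‖ ^ 2 * ‖w‖ ^ 2 := by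
      simp only [ha, Fintype.sum_prod_type, EuclideanSpace.real_norm_sq_eq, mul_pow,
        ← Finset.mul_sum, ← Finset.sum_mul]
    rw [this]
    have h1 := pow_le_one₀ (n := 2) (norm_nonneg u) (hle₁ u hx.1)
    have h2 := pow_le_one₀ (n := 2) (norm_nonneg v) (hle₂ v hx.2.1)
    have h3 := pow_le_one₀ (n := 2) (norm_nonneg w) (hle₃ w hx.2.2)
    exact mul_le_one₀ (mul_le_one₀ h1 (by positivity) h2) (by positivity) h3
  set dim : ℝ := ((p₁ + p₂ + T : ℕ) : ℝ) with hdimdef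
  have hdim1 : 1 ≤ dim := by
    rw [hdimdef]
    exact_mod_cast hdim
  -- The product net has log-cardinality at most `2 * dim`, so `l = √dim` balances the maximal
  -- inequality and yields `7 / 2 * √dim`. The factor `8 = 2 ^ 3` for passing from nets to the
  -- spectral norm makes this `28`.
  have hmax := sum_signs_sup'_le E hEne a hasq (l := √dim) (Real.sqrt_pos.2 (by linarith))
  have hlog : Real.log E.card ≤ 2 * dim := by
    have h1 : Real.log E.card ≤ dim * Real.log 5 := by
      rw [hdimdef, ← Real.log_pow]
      exact Real.log_le_log (by exact_mod_cast hEne.card_pos) hEcard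
    have h2 : Real.log 5 ≤ 2 := by
      rw [Real.log_le_iff_le_exp (by norm_num)]
      have := Real.add_one_le_exp (1 : ℝ)
      have h3 : Real.exp 2 = Real.exp 1 * Real.exp 1 := by rw [← Real.exp_add]; norm_num
      have h4 := Real.exp_one_gt_d9
      nlinarith
    nlinarith
  have hbound : (Real.log E.card + √dim ^ 2 / 2 + 1) / √dim ≤ 7 / 2 * √dim := by
    rw [div_le_iff₀ (Real.sqrt_pos.2 (by linarith)), mul_assoc, ← pow_two,
      Real.sq_sqrt (by linarith)]
    linarith
  have hpoint : ∀ ξ : Fin p₁ × Fin p₂ × Fin T → ℤˣ,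
      D.sup' hD (fun i => ∑ s, signVal (ξ s) * Δ i s) ≤
        8 * (κ₁ * κ₂) * r * E.sup' hEne (fun x => ∑ s, signVal (ξ s) * a x s) := by
    intro ξ
    set c := E.sup' hEne (fun x => ∑ s, signVal (ξ s) * a x s) with hc
    have htri := trilinear_le_of_net hN₁ hN₂ hN₃ hnet₁ hnet₂ hnet₃ (fun s => signVal (ξ s))
      (c := c) (fun u hu v hv w hw => Finset.le_sup' (fun x => ∑ s, signVal (ξ s) * a x s)
        (show (u, v, w) ∈ E by simp [hE, hu, hv, hw]))
    have hc0 : 0 ≤ c := by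
      by_contra! hneg
      obtain ⟨u, hu⟩ := hN₁
      obtain ⟨v, hv⟩ := hN₂
      obtain ⟨w, hw⟩ := hN₃
      have h1 : trilinear (fun s => signVal (ξ s)) u v w ≤ c :=
        Finset.le_sup' (fun x => ∑ s, signVal (ξ s) * a x s)
          (show (u, v, w) ∈ E by simp [hE, hu, hv, hw])
      have h2 := htri (-u) v w
      have h3 : trilinear (fun s => signVal (ξ s)) ((-u : EuclideanSpace ℝ (Fin p₁)) : _) v w =
          -trilinear (fun s => signVal (ξ s)) u v w := by
        simp [trilinear]
      have h4 : 8 * c * ‖-u‖ * ‖v‖ * ‖w‖ ≤ 0 := by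
        have : 0 ≤ ‖-u‖ * ‖v‖ * ‖w‖ := by positivity
        nlinarith
      linarith
    refine Finset.sup'_le _ _ fun i hi => ?_
    have := (hrank i hi).sum_mul_le (ξ := fun s => signVal (ξ s)) (c := 8 * c) (by linarith)
      htri hr (hΔ i hi)
    refine this.trans (le_of_eq ?_)
    ring
  refine (Finset.sum_le_sum fun ξ _ => hpoint ξ).trans ?_
  rw [← Finset.mul_sum]
  have h8 : (0 : ℝ) ≤ 8 * (κ₁ * κ₂) * r := by positivity
  refine (mul_le_mul_of_nonneg_left (hmax.trans
    (mul_le_mul_of_nonneg_left hbound (by positivity))) h8).trans (le_of_eq ?_)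
  ring

end LowRank

/-! ### The check loss: Lipschitz bound, convexity and Knight's identity -/

theorem checkLoss_eq_max (τ u : ℝ) : checkLoss τ u = max (τ * u) ((τ - 1) * u) := by
  unfold checkLoss
  split_ifs with h
  · rw [max_eq_right (by nlinarith)]; ring
  · rw [max_eq_left (by nlinarith)]; ring

theorem continuous_checkLoss (τ : ℝ) : Continuous (checkLoss τ) := by
  rw [show checkLoss τ = fun u => max (τ * u) ((τ - 1) * u) from funext (checkLoss_eq_max τ)]
  fun_prop

theorem abs_checkLoss_sub_le {τ : ℝ} (h0 : 0 < τ) (h1 : τ < 1) (u v : ℝ) :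
    |checkLoss τ u - checkLoss τ v| ≤ |u - v| := by
  rw [checkLoss_eq_max, checkLoss_eq_max]
  refine (abs_max_sub_max_le_max _ _ _ _).trans (max_le ?_ ?_)
  · rw [← mul_sub, abs_mul, abs_of_pos h0]
    exact mul_le_of_le_one_left (abs_nonneg _) h1.le
  · rw [← mul_sub, abs_mul, abs_of_neg (by linarith)]
    exact mul_le_of_le_one_left (abs_nonneg _) (by linarith)

/-- The increment `ρ_τ(e - d) - ρ_τ(e)` of the check loss. -/
noncomputable def lossIncr (τ e d : ℝ) : ℝ := checkLoss τ (e - d) - checkLoss τ e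

theorem lossIncr_zero (τ e : ℝ) : lossIncr τ e 0 = 0 := by simp [lossIncr]

theorem continuous_lossIncr (τ d : ℝ) : Continuous fun e => lossIncr τ e d := by
  have := continuous_checkLoss τ
  unfold lossIncr
  fun_prop

theorem abs_lossIncr_sub_le {τ : ℝ} (h0 : 0 < τ) (h1 : τ < 1) (e d d' : ℝ) :
    |lossIncr τ e d - lossIncr τ e d'| ≤ |d - d'| := by
  have := abs_checkLoss_sub_le h0 h1 (e - d) (e - d')
  unfold lossIncr
  rw [sub_sub_sub_cancel_right]
  rwa [sub_sub_sub_cancel_left, abs_sub_comm d' d] at this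

theorem abs_lossIncr_le {τ : ℝ} (h0 : 0 < τ) (h1 : τ < 1) (e d : ℝ) : |lossIncr τ e d| ≤ |d| := by
  simpa [lossIncr_zero] using abs_lossIncr_sub_le h0 h1 e d 0

/-- Convexity of the check loss, as a maximum of two linear functions, along the segment from `e` to
`e - d`. It allows an array to be shrunk radially without making a nonpositive total increment
positive. -/
theorem lossIncr_mul_le {τ : ℝ} (e d : ℝ) {l : ℝ} (hl0 : 0 ≤ l) (hl1 : l ≤ 1) :
    lossIncr τ e (l * d) ≤ l * lossIncr τ e d := by
  unfold lossIncr
  have h1 : τ * (e - d) ≤ checkLoss τ (e - d) := checkLoss_eq_max τ _ ▸ le_max_left _ _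
  have h2 : (τ - 1) * (e - d) ≤ checkLoss τ (e - d) := checkLoss_eq_max τ _ ▸ le_max_right _ _
  have h3 : τ * e ≤ checkLoss τ e := checkLoss_eq_max τ _ ▸ le_max_left _ _
  have h4 : (τ - 1) * e ≤ checkLoss τ e := checkLoss_eq_max τ _ ▸ le_max_right _ _
  have h5 : checkLoss τ (e - l * d) ≤ l * checkLoss τ (e - d) + (1 - l) * checkLoss τ e := by
    have hl1' : 0 ≤ 1 - l := by linarith
    rw [checkLoss_eq_max τ (e - l * d)]
    refine max_le ?_ ?_
    · have := mul_le_mul_of_nonneg_left h1 hl0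
      have := mul_le_mul_of_nonneg_left h3 hl1'
      linarith
    · have := mul_le_mul_of_nonneg_left h2 hl0
      have := mul_le_mul_of_nonneg_left h4 hl1'
      linarith
  linarith

/-- Knight's identity: the increment is a term linear in `d`, of mean zero when zero is the
`τ`-quantile, plus a nonnegative remainder that produces the quadratic growth. -/
theorem lossIncr_of_nonneg (τ e : ℝ) {d : ℝ} (hd : 0 ≤ d) :
    lossIncr τ e d = -d * τ + d * (Set.Iic (0 : ℝ)).indicator 1 e +
      (Set.Ioc 0 d).indicator (fun e => d - e) e := by
  unfold lossIncr checkLoss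
  rcases le_or_gt e 0 with h | h
  · rw [Set.indicator_of_mem (Set.mem_Iic.2 h), Set.indicator_of_notMem (by simp [h])]
    simp only [Pi.one_apply]
    split_ifs <;> nlinarith
  · rw [Set.indicator_of_notMem (by simp [h]), if_neg h.not_gt]
    by_cases hed : e ≤ d
    · rw [Set.indicator_of_mem (Set.mem_Ioc.2 ⟨h, hed⟩)]
      split_ifs <;> nlinarith
    · rw [Set.indicator_of_notMem (by simp [hed]), if_neg (by linarith)]
      ring

theorem lossIncr_of_nonpos (τ e : ℝ) {d : ℝ} (hd : d ≤ 0) :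
    lossIncr τ e d = -d * τ + d * (Set.Iic (0 : ℝ)).indicator 1 e +
      (Set.Ioc d 0).indicator (fun e => e - d) e := by
  unfold lossIncr checkLoss
  rcases le_or_gt e 0 with h | h
  · rw [Set.indicator_of_mem (Set.mem_Iic.2 h)]
    by_cases hed : d < e
    · rw [Set.indicator_of_mem (Set.mem_Ioc.2 ⟨hed, h⟩), if_neg (by linarith)]
      simp only [Pi.one_apply]
      split_ifs
      · ring
      · have : e = 0 := by linarith
        subst this
        ring
    · rw [Set.indicator_of_notMem (by simp [hed])]
      simp only [Pi.one_apply]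
      split_ifs <;> nlinarith
  · rw [Set.indicator_of_notMem (by simp [h]), Set.indicator_of_notMem (by simp [h]),
      if_neg h.not_gt, if_neg (by linarith)]
    ring

/-! ### Quadratic growth of the expected loss -/

section Density

/-- The law on `ℝ` with density `g`. -/
noncomputable def densityMeasure (g : ℝ → ℝ) : Measure ℝ :=
  (volume : Measure ℝ).withDensity fun u => ENNReal.ofReal (g u)

theorem IsDensityWithZeroQuantile.isProbabilityMeasure {τ : ℝ} {g : ℝ → ℝ}
    (hg : IsDensityWithZeroQuantile τ g) : IsProbabilityMeasure (densityMeasure g) :=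
  ⟨by rw [densityMeasure, withDensity_apply _ MeasurableSet.univ, Measure.restrict_univ, hg.2.2.1]⟩

theorem IsDensityWithZeroQuantile.measureReal_Iic {τ : ℝ} (hτ : 0 ≤ τ) {g : ℝ → ℝ}
    (hg : IsDensityWithZeroQuantile τ g) : (densityMeasure g).real (Set.Iic 0) = τ := by
  rw [measureReal_def, densityMeasure, withDensity_apply _ measurableSet_Iic, hg.2.2.2,
    ENNReal.toReal_ofReal hτ]

theorem mul_setIntegral_le_of_le_density {g : ℝ → ℝ} [IsFiniteMeasure (densityMeasure g)]
    {A : Set ℝ} (hA : MeasurableSet A) {c : ℝ} (hc : 0 ≤ c) (hgc : ∀ u ∈ A, c ≤ g u)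
    {h : ℝ → ℝ} (hh : Measurable h) (h0 : ∀ u ∈ A, 0 ≤ h u) {M : ℝ} (hM : ∀ u ∈ A, h u ≤ M) :
    c * ∫ u in A, h u ≤ ∫ u in A, h u ∂(densityMeasure g) := by
  have hle : ENNReal.ofReal c • (volume : Measure ℝ).restrict A ≤
      (densityMeasure g).restrict A := by
    refine Measure.le_iff.2 fun s hs => ?_
    rw [Measure.smul_apply, Measure.restrict_apply hs, Measure.restrict_apply hs, densityMeasure,
      withDensity_apply _ (hs.inter hA), smul_eq_mul, ← setLIntegral_const]
    exact setLIntegral_mono' (hs.inter hA) fun u hu => ENNReal.ofReal_le_ofReal (hgc u hu.2)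
  have hint : Integrable h ((densityMeasure g).restrict A) := by
    refine Integrable.of_bound hh.aestronglyMeasurable M ?_
    filter_upwards [ae_restrict_mem hA] with u hu
    rw [Real.norm_of_nonneg (h0 u hu)]
    exact hM u hu
  have := integral_mono_measure hle
    (by filter_upwards [ae_restrict_mem hA] with u hu using h0 u hu) hint
  rwa [integral_smul_measure, ENNReal.toReal_ofReal hc, smul_eq_mul] at this

/-- Quadratic growth of the expected check loss around the `τ`-quantile. -/
theorem IsDensityWithZeroQuantile.le_integral_lossIncr {τ : ℝ} (hτ : 0 < τ) {g : ℝ → ℝ}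
    (hg : IsDensityWithZeroQuantile τ g) {B c : ℝ} (hc : 0 ≤ c)
    (hgc : ∀ u ∈ Set.Icc (-B) B, c ≤ g u) {d : ℝ} (hd : |d| ≤ B) :
    c / 2 * d ^ 2 ≤ ∫ e, lossIncr τ e d ∂(densityMeasure g) := by
  have := hg.isProbabilityMeasure
  obtain ⟨hd1, hd2⟩ := abs_le.1 hd
  -- The linear part of Knight's identity integrates to `-d * τ + d * τ = 0`. Only the remainder is
  -- left, and there the density may be replaced by its lower bound `c`; integrating the linear ramp
  -- then gives `c / 2 * d ^ 2`.
  have hlin : ∀ (A : Set ℝ) (h : ℝ → ℝ), MeasurableSet A → Measurable h →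
      (∀ u ∈ A, 0 ≤ h u) → (∀ u ∈ A, h u ≤ B) → (∀ u ∈ A, c ≤ g u) →
      c * ∫ u in A, h u ≤ ∫ e, (-d * τ + d * (Set.Iic (0 : ℝ)).indicator 1 e + A.indicator h e)
        ∂(densityMeasure g) := by
    intro A h hA hh hh0 hhB hcA
    have hint : Integrable (A.indicator h) (densityMeasure g) := by
      refine Integrable.of_bound (hh.indicator hA).aestronglyMeasurable B
        (Eventually.of_forall fun u => ?_)
      by_cases hu : u ∈ A
      · rw [Set.indicator_of_mem hu, Real.norm_of_nonneg (hh0 u hu)]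
        exact hhB u hu
      · rw [Set.indicator_of_notMem hu, norm_zero]
        exact (abs_nonneg d).trans hd
    have hone : Integrable ((Set.Iic (0 : ℝ)).indicator (1 : ℝ → ℝ)) (densityMeasure g) :=
      (integrable_const (1 : ℝ)).indicator measurableSet_Iic
    have hadd : Integrable (fun e => -d * τ + d * (Set.Iic (0 : ℝ)).indicator (1 : ℝ → ℝ) e)
        (densityMeasure g) := (integrable_const _).add (hone.const_mul d)
    rw [integral_add hadd hint,
      integral_add (integrable_const _) (hone.const_mul d), integral_const, probReal_univ,
      one_smul, integral_const_mul, integral_indicator_one measurableSet_Iic,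
      hg.measureReal_Iic hτ.le, integral_indicator hA]
    have := mul_setIntegral_le_of_le_density hA hc hcA hh hh0 hhB
    linarith
  rcases le_total 0 d with h | h
  · simp only [lossIncr_of_nonneg τ _ h]
    refine le_trans (le_of_eq ?_) (hlin (Set.Ioc 0 d) (fun e => d - e) measurableSet_Ioc
      (by fun_prop) (fun u hu => by linarith [hu.2]) (fun u hu => by linarith [hu.1])
      (fun u hu => hgc u ⟨by linarith [hu.1], by linarith [hu.2]⟩))
    rw [← intervalIntegral.integral_of_le h, intervalIntegral.integral_sub (by simp) (by simp),
      intervalIntegral.integral_const, integral_id, smul_eq_mul]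
    ring
  · simp only [lossIncr_of_nonpos τ _ h]
    refine le_trans (le_of_eq ?_) (hlin (Set.Ioc d 0) (fun e => e - d) measurableSet_Ioc
      (by fun_prop) (fun u hu => by linarith [hu.1]) (fun u hu => by linarith [hu.2])
      (fun u hu => hgc u ⟨by linarith [hu.1], by linarith [hu.2]⟩))
    rw [← intervalIntegral.integral_of_le h, intervalIntegral.integral_sub (by simp) (by simp),
      intervalIntegral.integral_const, integral_id, smul_eq_mul]
    ring

end Density

/-! ### Symmetrization with a ghost sample -/

section Symmetrization

theorem integrable_finset_sup' {X ι : Type*} [TopologicalSpace X] [MeasurableSpace X]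
    [OpensMeasurableSpace X] (ν : Measure X) [IsFiniteMeasure ν] (D : Finset ι)
    (hD : D.Nonempty) {F : ι → X → ℝ} (hF : ∀ i ∈ D, Continuous (F i)) {b : ℝ}
    (hb : ∀ i ∈ D, ∀ x, |F i x| ≤ b) : Integrable (fun x => D.sup' hD fun i => F i x) ν := by
  refine Integrable.of_bound (Continuous.finset_sup'_apply hD hF).measurable.aestronglyMeasurable
    b (Eventually.of_forall fun x => ?_)
  obtain ⟨i, hi, h⟩ := D.exists_mem_eq_sup' hD (fun i => F i x)
  rw [h]
  exact hb i hi x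

variable {S : Type*} [Fintype S]

/-- Exchanging an observation with its ghost copy at `s` reverses the sign of the `s`-th difference,
so this invariance is what allows signs to be inserted. -/
theorem measurePreserving_swap_signs (μ : S → Measure ℝ) [∀ s, IsProbabilityMeasure (μ s)]
    (ξ : S → ℤˣ) :
    MeasurePreserving (fun (w : S → ℝ × ℝ) s => if ξ s = 1 then w s else (w s).swap)
      (Measure.pi fun s => (μ s).prod (μ s)) (Measure.pi fun s => (μ s).prod (μ s)) := by
  refine measurePreserving_pi (α := fun _ => ℝ × ℝ) (β := fun _ => ℝ × ℝ)
    (f := fun s w => if ξ s = 1 then w else w.swap) _ _ fun s => ?_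
  by_cases h : ξ s = 1
  · simp only [h, if_true]
    exact MeasurePreserving.id _
  · simp only [h, if_false]
    exact Measure.measurePreserving_swap

/-- Symmetrization with a ghost sample, followed by contraction: the expected supremum of a
centred process with Lipschitz increments is at most that of the Rademacher process. -/
theorem integral_sup'_centred_le [DecidableEq S] {ι : Type*} (D : Finset ι)
    (hD : D.Nonempty) (Δ : ι → S → ℝ)
    (μ : S → Measure ℝ) [∀ s, IsProbabilityMeasure (μ s)] {g : ℝ → ℝ → ℝ}
    (hg : ∀ d, Continuous fun e => g e d) (hlip : ∀ e d d', |g e d - g e d'| ≤ |d - d'|)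
    (hg0 : ∀ e, g e 0 = 0) :
    ∫ z, D.sup' hD (fun i => ∑ s, (∫ e, g e (Δ i s) ∂μ s - g (z s) (Δ i s))) ∂(Measure.pi μ) ≤
      (2 ^ Fintype.card S)⁻¹ * ∑ ξ : S → ℤˣ, D.sup' hD (fun i => ∑ s, signVal (ξ s) *
        (2 * Δ i s)) := by
  set ν : Measure (S → ℝ × ℝ) := Measure.pi fun s => (μ s).prod (μ s) with hν
  have hgb : ∀ e d, |g e d| ≤ |d| := fun e d => by simpa [hg0] using hlip e d 0
  set H : (S → ℤˣ) → (S → ℝ × ℝ) → ℝ := fun ξ w =>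
    D.sup' hD (fun i => ∑ s, signVal (ξ s) * (g (w s).2 (Δ i s) - g (w s).1 (Δ i s))) with hH
  set b : ℝ := ∑ i ∈ D, ∑ s, 2 * |Δ i s| with hbdef
  have hb : ∀ i ∈ D, ∑ s, 2 * |Δ i s| ≤ b := fun i hi =>
    Finset.single_le_sum (f := fun i => ∑ s, 2 * |Δ i s|)
      (fun _ _ => Finset.sum_nonneg fun _ _ => by positivity) hi
  have hterm : ∀ (i : ι) (u v : S → ℝ), |∑ s, (g (u s) (Δ i s) - g (v s) (Δ i s))| ≤
      ∑ s, 2 * |Δ i s| := fun i u v =>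
    (Finset.abs_sum_le_sum_abs _ _).trans (Finset.sum_le_sum fun s _ => by
      have h1 := abs_sub (g (u s) (Δ i s)) (g (v s) (Δ i s))
      have h2 := hgb (u s) (Δ i s)
      have h3 := hgb (v s) (Δ i s)
      linarith)
  have habs : ∀ e : ℤˣ, |signVal e| = 1 := fun e => by
    rcases Int.units_eq_one_or e with rfl | rfl
    · rw [signVal_one, abs_one]
    · rw [signVal_neg_one, abs_neg, abs_one]
  have hterm' : ∀ (i : ι) (ξ : S → ℤˣ) (w : S → ℝ × ℝ),
      |∑ s, signVal (ξ s) * (g (w s).2 (Δ i s) - g (w s).1 (Δ i s))| ≤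
      ∑ s, 2 * |Δ i s| := fun i ξ w =>
    (Finset.abs_sum_le_sum_abs _ _).trans (Finset.sum_le_sum fun s _ => by
      rw [abs_mul, habs, one_mul]
      have h1 := abs_sub (g (w s).2 (Δ i s)) (g (w s).1 (Δ i s))
      have h2 := hgb (w s).2 (Δ i s)
      have h3 := hgb (w s).1 (Δ i s)
      linarith)
  have hcont : ∀ (i : ι) (ξ : S → ℤˣ), Continuous fun w : S → ℝ × ℝ =>
      ∑ s, signVal (ξ s) * (g (w s).2 (Δ i s) - g (w s).1 (Δ i s)) := fun i ξ => by
    refine continuous_finsetSum _ fun s _ => continuous_const.mul ?_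
    exact ((hg (Δ i s)).comp (continuous_snd.comp (continuous_apply s))).sub
      ((hg (Δ i s)).comp (continuous_fst.comp (continuous_apply s)))
  have hHint : ∀ ξ, Integrable (H ξ) ν := fun ξ =>
    integrable_finset_sup' ν D hD (fun i _ => hcont i ξ)
      fun i hi w => (hterm' i ξ w).trans (hb i hi)
  have hHmeas : ∀ ξ, Measurable (H ξ) := fun ξ =>
    (Continuous.finset_sup'_apply hD fun i _ => hcont i ξ).measurable
  -- the ghost sample
  have hghost : ∫ z, D.sup' hD (fun i => ∑ s, (∫ e, g e (Δ i s) ∂μ s - g (z s) (Δ i s)))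
      ∂(Measure.pi μ) ≤ ∫ w, H 1 w ∂ν := by
    have he := measurePreserving_arrowProdEquivProdArrow ℝ ℝ S μ μ
    set G : (S → ℝ) × (S → ℝ) → ℝ := fun q =>
      D.sup' hD (fun i => ∑ s, (g (q.2 s) (Δ i s) - g (q.1 s) (Δ i s))) with hG
    have hGc : ∀ i, Continuous fun q : (S → ℝ) × (S → ℝ) =>
        ∑ s, (g (q.2 s) (Δ i s) - g (q.1 s) (Δ i s)) := fun i =>
      continuous_finsetSum _ fun s _ =>
        ((hg (Δ i s)).comp ((continuous_apply s).comp continuous_snd)).sub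
          ((hg (Δ i s)).comp ((continuous_apply s).comp continuous_fst))
    have hGint : Integrable G ((Measure.pi μ).prod (Measure.pi μ)) :=
      integrable_finset_sup' _ D hD (fun i _ => hGc i)
        fun i hi q => (hterm i q.2 q.1).trans (hb i hi)
    have h1 : ∫ w, H 1 w ∂ν = ∫ q, G q ∂((Measure.pi μ).prod (Measure.pi μ)) := by
      rw [← he.integral_comp' G]
      refine integral_congr_ae (Eventually.of_forall fun w => ?_)
      simp only [hH, hG, Pi.one_apply, signVal_one, one_mul]
      rfl
    rw [h1, integral_prod _ hGint]
    have hsecint : ∀ z : S → ℝ, Integrable (fun z' => G (z, z')) (Measure.pi μ) := fun z =>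
      integrable_finset_sup' _ D hD
        (fun i _ => (hGc i).comp (continuous_const.prodMk continuous_id))
        fun i hi q => (hterm i q z).trans (hb i hi)
    have hcoord : ∀ s d, Integrable (fun z' : S → ℝ => g (z' s) d) (Measure.pi μ) := fun s d =>
      Integrable.of_bound ((hg d).comp (continuous_apply s)).aestronglyMeasurable |d|
        (Eventually.of_forall fun z => hgb _ _)
    refine integral_mono ?_ hGint.integral_prod_left fun z => Finset.sup'_le _ _ fun i hi => ?_
    · refine integrable_finset_sup' _ D hD (b := ∑ i ∈ D, ∑ s, 2 * |Δ i s|) (fun i _ =>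
        continuous_finsetSum _ fun s _ =>
          continuous_const.sub ((hg (Δ i s)).comp (continuous_apply s))) fun i hi z => ?_
      refine le_trans ((Finset.abs_sum_le_sum_abs _ _).trans (Finset.sum_le_sum fun s _ => ?_))
        (hb i hi)
      have h2 := abs_sub (∫ e, g e (Δ i s) ∂μ s) (g (z s) (Δ i s))
      have h3 : |∫ e, g e (Δ i s) ∂μ s| ≤ |Δ i s| := by
        have := norm_integral_le_of_norm_le_const (μ := μ s) (f := fun e => g e (Δ i s))
          (C := |Δ i s|) (Eventually.of_forall fun e => hgb e _)
        simpa using this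
      have h4 := hgb (z s) (Δ i s)
      linarith
    -- The exact mean is the integral over the ghost sample, and the supremum of integrals is at
    -- most the integral of the supremum.
    · have h5 : ∑ s, (∫ e, g e (Δ i s) ∂μ s - g (z s) (Δ i s)) =
          ∫ z', ∑ s, (g (z' s) (Δ i s) - g (z s) (Δ i s)) ∂(Measure.pi μ) := by
        have hdiff : ∀ s ∈ Finset.univ, Integrable (fun z' : S → ℝ =>
            g (z' s) (Δ i s) - g (z s) (Δ i s)) (Measure.pi μ) := fun s _ =>
          (hcoord s _).sub (integrable_const _)
        rw [integral_finsetSum _ hdiff]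
        refine Finset.sum_congr rfl fun s _ => ?_
        rw [integral_sub (hcoord s _) (integrable_const _), integral_const, probReal_univ,
          one_smul, ← (measurePreserving_eval μ s).map_eq,
          integral_map (measurable_pi_apply s).aemeasurable (hg _).aestronglyMeasurable]
      rw [h5]
      exact integral_mono (integrable_finsetSum _ fun s _ =>
        (hcoord s _).sub (integrable_const _)) (hsecint z) fun z' =>
          Finset.le_sup' (fun i => ∑ s, (g (z' s) (Δ i s) - g (z s) (Δ i s))) hi
  -- invariance under swaps
  have hswap : ∀ ξ, ∫ w, H ξ w ∂ν = ∫ w, H 1 w ∂ν := by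
    intro ξ
    have hmp := measurePreserving_swap_signs μ ξ
    conv_rhs => rw [hν, ← hmp.map_eq, integral_map hmp.measurable.aemeasurable
      (hHmeas 1).aestronglyMeasurable]
    refine integral_congr_ae (Eventually.of_forall fun w => ?_)
    simp only [hH, Pi.one_apply, signVal_one, one_mul]
    congr 1
    funext i
    refine Finset.sum_congr rfl fun s _ => ?_
    rcases Int.units_eq_one_or (ξ s) with h | h
    · simp [h, signVal_one]
    · rw [h, if_neg (by decide), signVal_neg_one]
      simp
  refine hghost.trans ?_
  rw [inv_mul_eq_div, le_div_iff₀ (by positivity), mul_comm]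
  calc (2 : ℝ) ^ Fintype.card S * ∫ w, H 1 w ∂ν = ∑ ξ, ∫ w, H ξ w ∂ν := by
        rw [Finset.sum_congr rfl fun ξ _ => hswap ξ, Finset.sum_const, Finset.card_univ,
          nsmul_eq_mul, card_signs]
    _ = ∫ w, ∑ ξ, H ξ w ∂ν := (integral_finsetSum _ fun ξ _ => hHint ξ).symm
    _ ≤ ∫ _w, ∑ ξ : S → ℤˣ, D.sup' hD (fun i => ∑ s, signVal (ξ s) * (2 * Δ i s)) ∂ν := by
        refine integral_mono (integrable_finsetSum _ fun ξ _ => hHint ξ) (integrable_const _)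
          fun w => ?_
        -- Contraction is applied for each fixed pair of samples. A difference of two increments,
        -- each `1`-Lipschitz in `d`, is `2`-Lipschitz, whence `2 * Δ i s`.
        refine sum_signs_sup'_le_of_contraction D hD (fun s i => 2 * Δ i s)
          (fun s i => g (w s).2 (Δ i s) - g (w s).1 (Δ i s)) fun s i j => ?_
        have h1 := hlip (w s).2 (Δ i s) (Δ j s)
        have h2 := hlip (w s).1 (Δ i s) (Δ j s)
        rw [← mul_sub, abs_mul, abs_two, sub_sub_sub_comm]
        have h3 := abs_sub (g (w s).2 (Δ i s) - g (w s).2 (Δ j s))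
          (g (w s).1 (Δ i s) - g (w s).1 (Δ j s))
        linarith
    _ = _ := by rw [integral_const, probReal_univ, one_smul]

end Symmetrization

/-! ### The bad event and the rate of convergence -/

section RateOfConvergence

variable {p₁ p₂ T : ℕ}

/-- The arrays of bounded mode ranks, with entries bounded by `B` and Frobenius norm `r`. -/
def modeRankSphere (p₁ p₂ T κ₁ κ₂ : ℕ) (B r : ℝ) : Set (Fin p₁ × Fin p₂ × Fin T → ℝ) :=
  {Δ | HasModeRankLE κ₁ κ₂ Δ ∧ (∀ s, |Δ s| ≤ B) ∧ ∑ s, Δ s ^ 2 = r ^ 2}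

/-- The errors for which the empirical loss is not bounded below quadratically on a sphere. -/
def badErrors (p₁ p₂ T κ₁ κ₂ : ℕ) (τ B r a : ℝ) : Set (Fin p₁ × Fin p₂ × Fin T → ℝ) :=
  ⋃ Δ : modeRankSphere p₁ p₂ T κ₁ κ₂ B r, {z | ∑ s, lossIncr τ (z s) (Δ.1 s) < a}

theorem isOpen_lossIncr_lt {S : Type*} [Fintype S] (τ : ℝ) (Δ : S → ℝ) (a : ℝ) :
    IsOpen {z : S → ℝ | ∑ s, lossIncr τ (z s) (Δ s) < a} :=
  isOpen_lt (continuous_finsetSum _ fun s _ =>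
    (continuous_lossIncr τ (Δ s)).comp (continuous_apply s)) continuous_const

/-- Openness makes the uncountable union measurable. It also lets its measure be computed on compact
subsets, each covered by finitely many of the pieces, so finite suprema suffice. -/
theorem isOpen_badErrors (p₁ p₂ T κ₁ κ₂ : ℕ) (τ B r a : ℝ) :
    IsOpen (badErrors p₁ p₂ T κ₁ κ₂ τ B r a) :=
  isOpen_iUnion fun _ => isOpen_lossIncr_lt _ _ _

/-- Outside the bad event, an array at which the loss does not increase has small norm. -/
theorem sum_sq_le_of_notMem_badErrors {κ₁ κ₂ : ℕ} {τ B r a : ℝ} (hr : 0 < r) (ha : 0 < a)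
    {z Δ : Fin p₁ × Fin p₂ × Fin T → ℝ} (hz : z ∉ badErrors p₁ p₂ T κ₁ κ₂ τ B r a)
    (hrank : HasModeRankLE κ₁ κ₂ Δ) (hB : ∀ s, |Δ s| ≤ B)
    (hloss : ∑ s, lossIncr τ (z s) (Δ s) ≤ 0) : ∑ s, Δ s ^ 2 ≤ r ^ 2 := by
  by_contra! hlt
  refine hz (Set.mem_iUnion.2 ?_)
  set m : ℝ := √(∑ s, Δ s ^ 2) with hm
  have hm2 : m ^ 2 = ∑ s, Δ s ^ 2 := Real.sq_sqrt (by positivity)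
  have hrm : r < m := by
    rw [hm]
    exact Real.lt_sqrt_of_sq_lt hlt
  have hm0 : 0 < m := hr.trans hrm
  have hl0 : 0 ≤ r / m := by positivity
  have hl1 : r / m ≤ 1 := (div_le_one hm0).2 hrm.le
  -- Shrink `Δ` radially onto the sphere; ranks and the entry bound survive, and convexity keeps the
  -- increment at most zero, hence below `a`.
  refine ⟨⟨fun s => r / m * Δ s, hrank.smul _, fun s => ?_, ?_⟩, ?_⟩
  · rw [abs_mul, abs_of_nonneg hl0]
    exact (mul_le_of_le_one_left (abs_nonneg _) hl1).trans (hB s)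
  · simp only [mul_pow, ← Finset.mul_sum, ← hm2]
    field_simp
  · refine lt_of_le_of_lt ?_ ha
    calc ∑ s, lossIncr τ (z s) (r / m * Δ s) ≤ ∑ s, r / m * lossIncr τ (z s) (Δ s) :=
          Finset.sum_le_sum fun s _ => lossIncr_mul_le _ _ hl0 hl1
      _ = r / m * ∑ s, lossIncr τ (z s) (Δ s) := by rw [Finset.mul_sum]
      _ ≤ 0 := mul_nonpos_of_nonneg_of_nonpos hl0 hloss

/-- On the sphere the mean increment is at least `c / 2 * r ^ 2`, so an increment below half of that
forces a centred deviation of at least `c / 4 * r ^ 2`. Markov's inequality concludes. The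
Rademacher bound at radius `2 * r` has constant `56`, and dividing by `c / 4` gives `224 / c`. -/
theorem measureReal_finset_lossIncr_lt_le {κ₁ κ₂ : ℕ} {τ B r c : ℝ} (hτ0 : 0 < τ) (hτ1 : τ < 1)
    (hr : 0 < r) (hc : 0 < c) (hdim : 0 < p₁ + p₂ + T)
    (g : Fin p₁ × Fin p₂ × Fin T → ℝ → ℝ) (hg : ∀ s, IsDensityWithZeroQuantile τ (g s))
    (hgc : ∀ s, ∀ u ∈ Set.Icc (-B) B, c ≤ g s u)
    (D : Finset (Fin p₁ × Fin p₂ × Fin T → ℝ))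
    (hD : ∀ Δ ∈ D, Δ ∈ modeRankSphere p₁ p₂ T κ₁ κ₂ B r) :
    (Measure.pi fun s => densityMeasure (g s)).real
        {z | ∃ Δ ∈ D, ∑ s, lossIncr τ (z s) (Δ s) < c / 4 * r ^ 2} ≤
      224 * (κ₁ * κ₂) * √((p₁ + p₂ + T : ℕ) : ℝ) / (c * r) := by
  classical
  have hprob : ∀ s, IsProbabilityMeasure (densityMeasure (g s)) := fun s =>
    (hg s).isProbabilityMeasure
  set μ := Measure.pi fun s => densityMeasure (g s) with hμ
  -- Adding the zero array makes the index set nonempty and the supremum nonnegative, as Markov's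
  -- inequality requires.
  set D' := insert (0 : Fin p₁ × Fin p₂ × Fin T → ℝ) D with hD'
  have hD'ne : D'.Nonempty := Finset.insert_nonempty _ _
  have h0mem : (0 : Fin p₁ × Fin p₂ × Fin T → ℝ) ∈ D' := Finset.mem_insert_self _ _
  set F : (Fin p₁ × Fin p₂ × Fin T → ℝ) → ℝ := fun z => D'.sup' hD'ne fun Δ =>
    ∑ s, (∫ e, lossIncr τ e (Δ s) ∂densityMeasure (g s) - lossIncr τ (z s) (Δ s)) with hF
  have hF0 : ∀ z, 0 ≤ F z := fun z => by
    refine le_trans (le_of_eq ?_) (Finset.le_sup' (fun Δ : Fin p₁ × Fin p₂ × Fin T → ℝ =>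
      ∑ s, (∫ e, lossIncr τ e (Δ s) ∂densityMeasure (g s) - lossIncr τ (z s) (Δ s))) h0mem)
    simp [lossIncr_zero]
  have hFint : Integrable F μ := by
    refine integrable_finset_sup' _ D' hD'ne (b := ∑ Δ ∈ D', ∑ s, 2 * |Δ s|) (fun Δ _ =>
      continuous_finsetSum _ fun s _ => continuous_const.sub
        ((continuous_lossIncr τ (Δ s)).comp (continuous_apply s))) fun Δ hΔ z => ?_
    refine le_trans ((Finset.abs_sum_le_sum_abs _ _).trans (Finset.sum_le_sum fun s _ => ?_))
      (Finset.single_le_sum (f := fun Δ : Fin p₁ × Fin p₂ × Fin T → ℝ => ∑ s, 2 * |Δ s|)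
        (fun _ _ => Finset.sum_nonneg fun _ _ => by positivity) hΔ)
    have h2 := abs_sub (∫ e, lossIncr τ e (Δ s) ∂densityMeasure (g s)) (lossIncr τ (z s) (Δ s))
    have h3 : |∫ e, lossIncr τ e (Δ s) ∂densityMeasure (g s)| ≤ |Δ s| := by
      have := norm_integral_le_of_norm_le_const (μ := densityMeasure (g s))
        (f := fun e => lossIncr τ e (Δ s)) (C := |Δ s|)
        (Eventually.of_forall fun e => abs_lossIncr_le hτ0 hτ1 e _)
      simpa using this
    have h4 := abs_lossIncr_le hτ0 hτ1 (z s) (Δ s)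
    linarith
  have hint : ∫ z, F z ∂μ ≤ 56 * (κ₁ * κ₂) * r * √((p₁ + p₂ + T : ℕ) : ℝ) := by
    refine (integral_sup'_centred_le D' hD'ne (fun Δ => Δ) (fun s => densityMeasure (g s))
      (continuous_lossIncr τ) (abs_lossIncr_sub_le hτ0 hτ1) (lossIncr_zero τ)).trans ?_
    rw [inv_mul_le_iff₀ (by positivity)]
    refine (sum_signs_sup'_modeRank_le D' hD'ne (fun Δ s => 2 * Δ s) (κ₁ := κ₁) (κ₂ := κ₂)
      (r := 2 * r) (fun Δ hΔ => ?_) (by positivity) (fun Δ hΔ => ?_) hdim).trans (le_of_eq ?_)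
    · rcases Finset.mem_insert.1 hΔ with rfl | hΔ
      · exact (hasModeRankLE_zero κ₁ κ₂).smul 2
      · exact (hD Δ hΔ).1.smul 2
    · simp only [mul_pow, ← Finset.mul_sum]
      refine mul_le_mul_of_nonneg_left ?_ (by positivity)
      rcases Finset.mem_insert.1 hΔ with rfl | hΔ
      · simp only [Pi.zero_apply, ne_eq, OfNat.ofNat_ne_zero, not_false_eq_true, zero_pow,
          Finset.sum_const_zero]
        positivity
      · exact (hD Δ hΔ).2.2.le
    · ring
  have hsub : {z | ∃ Δ ∈ D, ∑ s, lossIncr τ (z s) (Δ s) < c / 4 * r ^ 2} ⊆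
      {z | c / 4 * r ^ 2 ≤ F z} := by
    rintro z ⟨Δ, hΔ, hlt⟩
    have h1 : ∑ s, c / 2 * Δ s ^ 2 ≤ ∑ s, ∫ e, lossIncr τ e (Δ s) ∂densityMeasure (g s) :=
      Finset.sum_le_sum fun s _ =>
        (hg s).le_integral_lossIncr hτ0 hc.le (hgc s) ((hD Δ hΔ).2.1 s)
    rw [← Finset.mul_sum, (hD Δ hΔ).2.2] at h1
    have h2 : ∑ s, (∫ e, lossIncr τ e (Δ s) ∂densityMeasure (g s) - lossIncr τ (z s) (Δ s)) ≤
        F z := Finset.le_sup' (fun Δ : Fin p₁ × Fin p₂ × Fin T → ℝ =>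
      ∑ s, (∫ e, lossIncr τ e (Δ s) ∂densityMeasure (g s) - lossIncr τ (z s) (Δ s)))
      (Finset.mem_insert_of_mem hΔ)
    rw [Finset.sum_sub_distrib] at h2
    show c / 4 * r ^ 2 ≤ F z
    linarith
  have hmarkov := mul_meas_ge_le_integral_of_nonneg (Eventually.of_forall hF0) hFint
    (c / 4 * r ^ 2)
  have h3 := measureReal_mono (μ := μ) hsub
  rw [le_div_iff₀ (by positivity)]
  have h4 : c / 4 * r ^ 2 * μ.real {z | ∃ Δ ∈ D, ∑ s, lossIncr τ (z s) (Δ s) < c / 4 * r ^ 2} ≤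
      56 * (κ₁ * κ₂) * r * √((p₁ + p₂ + T : ℕ) : ℝ) :=
    (mul_le_mul_of_nonneg_left h3 (by positivity)).trans (hmarkov.trans hint)
  refine le_of_mul_le_mul_left ?_ hr
  linarith

/-- The bad event has small probability. -/
theorem measure_badErrors_le {κ₁ κ₂ : ℕ} {τ B r c : ℝ} (hτ0 : 0 < τ) (hτ1 : τ < 1)
    (hr : 0 < r) (hc : 0 < c) (hdim : 0 < p₁ + p₂ + T)
    (g : Fin p₁ × Fin p₂ × Fin T → ℝ → ℝ) (hg : ∀ s, IsDensityWithZeroQuantile τ (g s))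
    (hgc : ∀ s, ∀ u ∈ Set.Icc (-B) B, c ≤ g s u) :
    (Measure.pi fun s => densityMeasure (g s)) (badErrors p₁ p₂ T κ₁ κ₂ τ B r (c / 4 * r ^ 2)) ≤
      ENNReal.ofReal (224 * (κ₁ * κ₂) * √((p₁ + p₂ + T : ℕ) : ℝ) / (c * r)) := by
  classical
  have hprob : ∀ s, IsProbabilityMeasure (densityMeasure (g s)) := fun s =>
    (hg s).isProbabilityMeasure
  rw [(isOpen_badErrors p₁ p₂ T κ₁ κ₂ τ B r _).measure_eq_iSup_isCompact]
  refine iSup₂_le fun K hK => iSup_le fun hKc => ?_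
  obtain ⟨t, ht⟩ := hKc.elim_finite_subcover _ (fun _ => isOpen_lossIncr_lt _ _ _) hK
  rw [← ofReal_measureReal]
  refine ENNReal.ofReal_le_ofReal (le_trans (measureReal_mono ?_)
    (measureReal_finset_lossIncr_lt_le (κ₁ := κ₁) (κ₂ := κ₂) hτ0 hτ1 hr hc hdim g hg hgc
      (t.image Subtype.val) fun Δ hΔ => ?_))
  · intro z hz
    obtain ⟨Δ, hΔ, hzΔ⟩ := Set.mem_iUnion₂.1 (ht hz)
    exact ⟨Δ.1, Finset.mem_image_of_mem _ hΔ, hzΔ⟩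
  · obtain ⟨x, -, rfl⟩ := Finset.mem_image.1 hΔ
    exact x.2

end RateOfConvergence

/-! ### Counting eigenvalues of diagonal matrices -/

section Eigenvalues

open Polynomial in
theorem eigenvalues_multiset_eq_of_isDiag {m : ℕ} {A : Matrix (Fin m) (Fin m) ℝ}
    (hA : A.IsHermitian) (hdiag : A.IsDiag) :
    Multiset.map hA.eigenvalues Finset.univ.val =
      Multiset.map (fun j => A j j) Finset.univ.val := by
  have h1 : A.charpoly.roots = Multiset.map hA.eigenvalues Finset.univ.val := by
    simpa using hA.roots_charpoly_eq_eigenvalues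
  have h2 : A.charpoly = (Multiset.map (fun a => X - C a)
      (Multiset.map (fun j => A j j) (Finset.univ : Finset (Fin m)).val)).prod := by
    conv_lhs => rw [← hdiag.diagonal_diag, Matrix.charpoly_diagonal]
    rw [Multiset.map_map]
    rfl
  rw [← h1, h2, Polynomial.roots_multiset_prod_X_sub_C]

theorem countEigenvaluesAbove_eq_card {m : ℕ} {A : Matrix (Fin m) (Fin m) ℝ}
    (hA : A.IsHermitian) (hdiag : A.IsDiag) (c : ℝ) :
    countEigenvaluesAbove hA c = (Finset.univ.filter fun j => c < A j j).card := by
  classical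
  have h := congrArg (fun s => Multiset.countP (fun x => c < x) s)
    (eigenvalues_multiset_eq_of_isDiag hA hdiag)
  simp only [Multiset.countP_map] at h
  rw [countEigenvaluesAbove, Fintype.card_subtype]
  exact h

/-- Monotonicity of the diagonal reduces the count to the entries with zero-based indices `k` and `k
- 1`. Writing the latter as `j.val + 1 = k` makes its condition vacuous for `k = 0`. -/
theorem countEigenvaluesAbove_eq {m k : ℕ} {A : Matrix (Fin m) (Fin m) ℝ}
    (hA : A.IsHermitian) (hdec : IsDiagDecreasing A) (hk : k < m) {c : ℝ}
    (hle : A ⟨k, hk⟩ ⟨k, hk⟩ ≤ c) (hlt : ∀ j : Fin m, j.val + 1 = k → c < A j j) :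
    countEigenvaluesAbove hA c = k := by
  rw [countEigenvaluesAbove_eq_card hA hdec.1]
  have : (Finset.univ.filter fun j => c < A j j) = Finset.Iio (⟨k, hk⟩ : Fin m) := by
    ext j
    rw [Finset.mem_filter, Finset.mem_Iio]
    refine ⟨fun h => ?_, fun h => ⟨Finset.mem_univ _, ?_⟩⟩
    · by_contra hcon
      have := hdec.2 (not_lt.1 hcon)
      simp only at this
      linarith [h.2]
    · have hk0 : 0 < k := lt_of_le_of_lt (Nat.zero_le _) (Fin.lt_def.1 h)
      have h1 := hlt ⟨k - 1, by omega⟩ (by simp only; omega)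
      have h2 : A ⟨k - 1, by omega⟩ ⟨k - 1, by omega⟩ ≤ A j j :=
        hdec.2 (Fin.le_def.2 (by have := Fin.lt_def.1 h; simp only at this ⊢; omega))
      exact h1.trans_le h2
  rw [this, Fin.card_Iio]

end Eigenvalues

/-! ### Common components: transposition, mode ranks and uniform bounds -/

section CommonComponent

variable {p₁ p₂ T : ℕ}

theorem FactorParam.common_eq_sum {a b : ℕ} (θ : FactorParam p₁ p₂ T a b) (i : Fin p₁)
    (j : Fin p₂) (t : Fin T) :
    θ.common i j t = ∑ d, (∑ c, θ.R i c * θ.F t c d) * θ.C j d := by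
  simp [FactorParam.common, Matrix.mul_apply]

/-- The parameter of the transposed model. -/
def FactorParam.transpose {a b : ℕ} (θ : FactorParam p₁ p₂ T a b) : FactorParam p₂ p₁ T b a :=
  ⟨θ.C, fun t => (θ.F t).transpose, θ.R⟩

theorem FactorParam.common_transpose {a b : ℕ} (θ : FactorParam p₁ p₂ T a b) (i : Fin p₁)
    (j : Fin p₂) (t : Fin T) : θ.transpose.common j i t = θ.common i j t := by
  have : θ.C * (θ.F t).transpose * θ.R.transpose = (θ.R * θ.F t * θ.C.transpose).transpose := by
    simp [Matrix.transpose_mul, Matrix.mul_assoc]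
  simp only [FactorParam.common, FactorParam.transpose, this, Matrix.transpose_apply]

theorem FactorParam.rowMoment_transpose {a b : ℕ} (θ : FactorParam p₁ p₂ T a b) :
    rowMoment θ.transpose.F = colMoment θ.F := by
  simp [rowMoment, colMoment, FactorParam.transpose]

/-- The array of differences of two common components. -/
def commonDiff {a b a' b' : ℕ} (θ : FactorParam p₁ p₂ T a b) (θ' : FactorParam p₁ p₂ T a' b') :
    Fin p₁ × Fin p₂ × Fin T → ℝ :=
  fun s => θ.common s.1 s.2.1 s.2.2 - θ'.common s.1 s.2.1 s.2.2

theorem commonDiff_comm_sq {a b a' b' : ℕ} (θ : FactorParam p₁ p₂ T a b)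
    (θ' : FactorParam p₁ p₂ T a' b') :
    ∑ s, commonDiff θ' θ s ^ 2 = ∑ s, commonDiff θ θ' s ^ 2 :=
  Finset.sum_congr rfl fun s _ => by rw [commonDiff, commonDiff]; ring

theorem sum_sq_commonDiff_transpose {a b a' b' : ℕ} (θ : FactorParam p₁ p₂ T a b)
    (θ' : FactorParam p₁ p₂ T a' b') :
    ∑ s, commonDiff θ.transpose θ'.transpose s ^ 2 = ∑ s, commonDiff θ θ' s ^ 2 := by
  simp only [commonDiff, FactorParam.common_transpose, Fintype.sum_prod_type]
  exact Finset.sum_comm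

/-- Every mode-one fibre is a combination of the columns of the two loading matrices. The second
mode follows by transposition. -/
theorem exists_mode_subspace {a b a' b' : ℕ} (θ : FactorParam p₁ p₂ T a b)
    (θ' : FactorParam p₁ p₂ T a' b') :
    ∃ W : Submodule ℝ (EuclideanSpace ℝ (Fin p₁)), Module.finrank ℝ W ≤ a + a' ∧
      ∀ j t, WithLp.toLp 2 (fun i => commonDiff θ θ' (i, j, t)) ∈ W := by
  let v : Fin a ⊕ Fin a' → EuclideanSpace ℝ (Fin p₁) :=
    Sum.elim (fun c => WithLp.toLp 2 fun i => θ.R i c) (fun c => WithLp.toLp 2 fun i => θ'.R i c)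
  have hv : ∀ c, v c ∈ Submodule.span ℝ (Set.range v) := fun c =>
    Submodule.subset_span (Set.mem_range_self c)
  refine ⟨Submodule.span ℝ (Set.range v), ?_, fun j t => ?_⟩
  · have := finrank_range_le_card (R := ℝ) v
    simpa [Set.finrank] using this
  · have h : WithLp.toLp 2 (fun i => commonDiff θ θ' (i, j, t)) =
        ∑ c, (∑ d, θ.F t c d * θ.C j d) • v (Sum.inl c) -
          ∑ c, (∑ d, θ'.F t c d * θ'.C j d) • v (Sum.inr c) := by
      ext i
      simp only [commonDiff, FactorParam.common_eq_sum, v, Sum.elim_inl, Sum.elim_inr,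
        WithLp.ofLp_sub, WithLp.ofLp_sum, WithLp.ofLp_smul, Pi.sub_apply, Finset.sum_apply,
        Pi.smul_apply, smul_eq_mul, Finset.sum_mul]
      congr 1 <;>
      · rw [Finset.sum_comm]
        exact Finset.sum_congr rfl fun c _ => Finset.sum_congr rfl fun d _ => by ring
    rw [h]
    exact sub_mem (Submodule.sum_mem _ fun c _ => Submodule.smul_mem _ _ (hv _))
      (Submodule.sum_mem _ fun c _ => Submodule.smul_mem _ _ (hv _))

theorem hasModeRankLE_commonDiff {a b a' b' : ℕ} (θ : FactorParam p₁ p₂ T a b)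
    (θ' : FactorParam p₁ p₂ T a' b') : HasModeRankLE (a + a') (b + b') (commonDiff θ θ') := by
  refine ⟨exists_mode_subspace θ θ', ?_⟩
  obtain ⟨W, hW, hmem⟩ := exists_mode_subspace θ.transpose θ'.transpose
  refine ⟨W, hW, fun i t => ?_⟩
  have := hmem i t
  simpa only [commonDiff, FactorParam.common_transpose] using this

/-- Common components are uniformly bounded over a parameter space built from compact sets. -/
theorem exists_common_bound {a b : ℕ} {𝒜 : Set (Fin a → ℝ)} {ℱ : Set (Matrix (Fin a) (Fin b) ℝ)}
    {ℬ : Set (Fin b → ℝ)} (h𝒜 : IsCompact 𝒜) (hℱ : IsCompact ℱ) (hℬ : IsCompact ℬ) :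
    ∃ B : ℝ, ∀ (p₁ p₂ T : ℕ) (θ : FactorParam p₁ p₂ T a b), θ ∈ paramSpace p₁ p₂ T 𝒜 ℱ ℬ →
      ∀ i j t, |θ.common i j t| ≤ B := by
  have hcont : Continuous fun q : (Fin a → ℝ) × Matrix (Fin a) (Fin b) ℝ × (Fin b → ℝ) =>
      ∑ d, (∑ c, q.1 c * q.2.1 c d) * q.2.2 d := by
    refine continuous_finsetSum _ fun d _ => Continuous.mul (continuous_finsetSum _ fun c _ =>
      Continuous.mul ?_ ?_) ?_
    · exact (continuous_apply c).comp continuous_fst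
    · exact (continuous_fst.comp continuous_snd).matrix_elem c d
    · exact (continuous_apply d).comp (continuous_snd.comp continuous_snd)
  obtain ⟨B, hB⟩ := (h𝒜.prod (hℱ.prod hℬ)).exists_bound_of_continuousOn hcont.continuousOn
  refine ⟨B, fun p₁ p₂ T θ hθ i j t => ?_⟩
  rw [FactorParam.common_eq_sum]
  exact hB (θ.R i, θ.F t, θ.C j) ⟨hθ.1 i, hθ.2.1 t, hθ.2.2.1 j⟩

end CommonComponent

/-! ### Weyl's inequality for normalized factor models -/

section Weyl

open Matrix

variable {p₁ p₂ T : ℕ}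

theorem sum_sq_mulVec_of_normalized {p a : ℕ} {R : Matrix (Fin p) (Fin a) ℝ}
    (hR : R.transpose * R = (p : ℝ) • (1 : Matrix (Fin a) (Fin a) ℝ)) (w : Fin a → ℝ) :
    ∑ i, (R *ᵥ w) i ^ 2 = p * ∑ c, w c ^ 2 := by
  have h : (R *ᵥ w) ⬝ᵥ (R *ᵥ w) = (p : ℝ) * (w ⬝ᵥ w) := by
    rw [dotProduct_mulVec, vecMul_mulVec, hR, vecMul_smul, vecMul_one, smul_dotProduct,
      smul_eq_mul]
  simpa only [dotProduct, pow_two] using h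

/-- Bessel's inequality for normalized loadings. -/
theorem sum_sq_vecMul_le_of_normalized {p a : ℕ} {R : Matrix (Fin p) (Fin a) ℝ} (hp : 0 < p)
    (hR : R.transpose * R = (p : ℝ) • (1 : Matrix (Fin a) (Fin a) ℝ)) (x : Fin p → ℝ) :
    ∑ c, (x ᵥ* R) c ^ 2 ≤ p * ∑ i, x i ^ 2 := by
  have hp' : (0 : ℝ) < p := by exact_mod_cast hp
  set w := x ᵥ* R with hw
  have h1 := sum_sq_mulVec_of_normalized hR w
  have h2 : ∑ i, x i * (R *ᵥ w) i = ∑ c, w c ^ 2 := by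
    have : x ⬝ᵥ (R *ᵥ w) = w ⬝ᵥ w := by rw [dotProduct_mulVec]
    simpa only [dotProduct, pow_two] using this
  -- Bessel's inequality by expanding the squared norm of `p x - R Rᵀ x`.
  have h3 : 0 ≤ ∑ i, (p * x i - (R *ᵥ w) i) ^ 2 := Finset.sum_nonneg fun _ _ => sq_nonneg _
  have h4 : ∑ i, (p * x i - (R *ᵥ w) i) ^ 2 =
      p ^ 2 * ∑ i, x i ^ 2 - 2 * p * ∑ i, x i * (R *ᵥ w) i + ∑ i, (R *ᵥ w) i ^ 2 := by
    rw [Finset.mul_sum, Finset.mul_sum, ← Finset.sum_sub_distrib, ← Finset.sum_add_distrib]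
    exact Finset.sum_congr rfl fun i _ => by ring
  rw [h4, h1, h2] at h3
  refine le_of_mul_le_mul_left ?_ hp'
  linarith

/-- The contraction of an array with a vector along the first mode. -/
def modeProj (x : Fin p₁ → ℝ) (Δ : Fin p₁ × Fin p₂ × Fin T → ℝ) (q : Fin p₂ × Fin T) : ℝ :=
  ∑ i, x i * Δ (i, q.1, q.2)

theorem sum_sq_modeProj_le (x : Fin p₁ → ℝ) (Δ : Fin p₁ × Fin p₂ × Fin T → ℝ) :
    ∑ q, modeProj x Δ q ^ 2 ≤ (∑ i, x i ^ 2) * ∑ s, Δ s ^ 2 := by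
  calc ∑ q, modeProj x Δ q ^ 2
      ≤ ∑ q : Fin p₂ × Fin T, (∑ i, x i ^ 2) * ∑ i, Δ (i, q.1, q.2) ^ 2 :=
        Finset.sum_le_sum fun q _ => Finset.sum_mul_sq_le_sq_mul_sq _ _ _
    _ = (∑ i, x i ^ 2) * ∑ s, Δ s ^ 2 := by
        rw [← Finset.mul_sum, Fintype.sum_prod_type (f := fun s => Δ s ^ 2), Finset.sum_comm]

/-- Up to scale `C` is an isometry, so what remains is the quadratic form of the diagonal row moment
at `Rᵀ x`. For normalized `R` its entries, times `p₁ p₂ T`, are therefore squared singular values of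
the mode-one unfolding. -/
theorem sum_sq_modeProj_common {a b : ℕ} (θ : FactorParam p₁ p₂ T a b) (hT : 0 < T)
    (hC : θ.C.transpose * θ.C = (p₂ : ℝ) • (1 : Matrix (Fin b) (Fin b) ℝ))
    (hdiag : (rowMoment θ.F).IsDiag) (x : Fin p₁ → ℝ) :
    ∑ q, modeProj x (fun s => θ.common s.1 s.2.1 s.2.2) q ^ 2 =
      p₂ * T * ∑ c, rowMoment θ.F c c * (x ᵥ* θ.R) c ^ 2 := by
  have hT' : (T : ℝ) ≠ 0 := by exact_mod_cast hT.ne'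
  set w := x ᵥ* θ.R with hw
  have h1 : ∀ j t, modeProj x (fun s => θ.common s.1 s.2.1 s.2.2) (j, t) =
      (θ.C *ᵥ (w ᵥ* θ.F t)) j := by
    intro j t
    have : (x ᵥ* (θ.R * θ.F t * θ.C.transpose)) j = (θ.C *ᵥ (w ᵥ* θ.F t)) j := by
      rw [← vecMul_vecMul, ← vecMul_vecMul, vecMul_transpose]
    rw [← this]
    rfl
  have h2 : ∀ t, ∑ j, (θ.C *ᵥ (w ᵥ* θ.F t)) j ^ 2 =
      p₂ * (w ⬝ᵥ ((θ.F t * (θ.F t).transpose) *ᵥ w)) := by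
    intro t
    rw [sum_sq_mulVec_of_normalized hC, ← mulVec_mulVec, dotProduct_mulVec, mulVec_transpose]
    simp only [dotProduct, pow_two]
  have h3 : ∑ t, w ⬝ᵥ ((θ.F t * (θ.F t).transpose) *ᵥ w) = T * (w ⬝ᵥ (rowMoment θ.F *ᵥ w)) := by
    rw [rowMoment, smul_mulVec, dotProduct_smul, smul_eq_mul, mul_inv_cancel_left₀ hT',
      sum_mulVec, dotProduct_sum]
  have h4 : w ⬝ᵥ (rowMoment θ.F *ᵥ w) = ∑ c, rowMoment θ.F c c * w c ^ 2 := by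
    conv_lhs => rw [← hdiag.diagonal_diag]
    simp only [dotProduct, mulVec_diagonal, diag_apply]
    exact Finset.sum_congr rfl fun c _ => by ring
  rw [Fintype.sum_prod_type, Finset.sum_comm]
  simp only [h1, h2]
  rw [← Finset.mul_sum, h3, h4, mul_assoc]

/-- Extension by zero of a vector of the first `j + 1` coordinates. -/
def extendVec {a : ℕ} (j : Fin a) (v : Fin (j.val + 1) → ℝ) (c : Fin a) : ℝ :=
  if h : c.val < j.val + 1 then v ⟨c.val, h⟩ else 0

theorem exists_direction {a a' : ℕ} (j : Fin a) (M : Matrix (Fin a') (Fin a) ℝ) :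
    ∃ w : Fin a → ℝ, w ≠ 0 ∧ (∀ c, j < c → w c = 0) ∧ ∀ d : Fin a', d.val < j.val →
      (M *ᵥ w) d = 0 := by
  let f : (Fin (j.val + 1) → ℝ) →ₗ[ℝ] (Fin j.val → ℝ) :=
    -- There are `j + 1` unknowns and `j` equations, hence a nonzero kernel. The default `0` imposes
    -- no condition at indices beyond `a'`.
    { toFun := fun v d => if h : d.val < a' then (M *ᵥ extendVec j v) ⟨d.val, h⟩ else 0
      map_add' := fun v v' => by
        have : extendVec j (v + v') = extendVec j v + extendVec j v' := by
          funext c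
          simp only [extendVec, Pi.add_apply]
          split_ifs <;> simp
        funext d
        simp only [this, mulVec_add, Pi.add_apply]
        split_ifs <;> simp
      map_smul' := fun r v => by
        have : extendVec j (r • v) = r • extendVec j v := by
          funext c
          simp only [extendVec, Pi.smul_apply]
          split_ifs <;> simp
        funext d
        simp only [this, mulVec_smul, Pi.smul_apply, RingHom.id_apply]
        split_ifs <;> simp }
  have hker : LinearMap.ker f ≠ ⊥ := LinearMap.ker_ne_bot_of_finrank_lt (by simp)
  obtain ⟨v, hv, hv0⟩ := (Submodule.ne_bot_iff _).1 hker
  refine ⟨extendVec j v, fun h => hv0 ?_, fun c hc => ?_, fun d hd => ?_⟩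
  · funext c
    have h1 := congrFun h ⟨c.val, by omega⟩
    simpa [extendVec, Nat.lt_succ_iff.1 c.isLt] using h1
  · have := Fin.lt_def.1 hc
    rw [extendVec, dif_neg (by omega)]
  · have h1 := congrFun (LinearMap.mem_ker.1 hv) ⟨d.val, hd⟩
    simpa [f] using h1

/-- **Weyl's inequality** for the square roots of the diagonal row moments of two normalized
factor models. -/
theorem sqrt_rowMoment_le {a b a' b' : ℕ} (θ : FactorParam p₁ p₂ T a b)
    (θ' : FactorParam p₁ p₂ T a' b') (hp₁ : 0 < p₁) (hp₂ : 0 < p₂) (hT : 0 < T)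
    (hR : θ.R.transpose * θ.R = (p₁ : ℝ) • (1 : Matrix (Fin a) (Fin a) ℝ))
    (hC : θ.C.transpose * θ.C = (p₂ : ℝ) • (1 : Matrix (Fin b) (Fin b) ℝ))
    (hR' : θ'.R.transpose * θ'.R = (p₁ : ℝ) • (1 : Matrix (Fin a') (Fin a') ℝ))
    (hC' : θ'.C.transpose * θ'.C = (p₂ : ℝ) • (1 : Matrix (Fin b') (Fin b') ℝ))
    (hD : IsDiagDecreasing (rowMoment θ.F)) (hD' : IsDiagDecreasing (rowMoment θ'.F))
    (j : Fin a) {e : ℝ} (he : 0 ≤ e) (hle : ∀ d : Fin a', j.val ≤ d.val → rowMoment θ'.F d d ≤ e) :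
    √(rowMoment θ.F j j) ≤ √e + √((∑ s, commonDiff θ θ' s ^ 2) / (p₁ * p₂ * T)) := by
  have hp₁' : (0 : ℝ) < p₁ := by exact_mod_cast hp₁
  have hp₂' : (0 : ℝ) < p₂ := by exact_mod_cast hp₂
  have hT' : (0 : ℝ) < T := by exact_mod_cast hT
  -- The min-max test vector: `θ.R *ᵥ w` uses only the factors of `θ` of index at most `j` and is
  -- orthogonal to the columns of `θ'.R` of index below `j`. It thus sees moments at least the
  -- `j`-th for `θ` and at most `e` for `θ'`.
  obtain ⟨w, hw0, hwj, hwd⟩ := exists_direction j (θ'.R.transpose * θ.R)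
  set x := θ.R *ᵥ w with hx
  set n := ∑ c, w c ^ 2 with hn
  have hn0 : 0 < n := by
    obtain ⟨c, hc⟩ := Function.ne_iff.1 hw0
    exact Finset.sum_pos' (fun _ _ => sq_nonneg _) ⟨c, Finset.mem_univ _, by
      have : w c ≠ 0 := hc
      positivity⟩
  have hxn : ∑ i, x i ^ 2 = p₁ * n := sum_sq_mulVec_of_normalized hR w
  have hxR : x ᵥ* θ.R = (p₁ : ℝ) • w := by
    rw [hx, vecMul_mulVec, hR, vecMul_smul, vecMul_one]
  have hxR' : ∀ d : Fin a', d.val < j.val → (x ᵥ* θ'.R) d = 0 := fun d hd => by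
    have := hwd d hd
    rwa [← mulVec_mulVec, ← hx, mulVec_transpose] at this
  let A : EuclideanSpace ℝ (Fin p₂ × Fin T) :=
    WithLp.toLp 2 (modeProj x fun s => θ.common s.1 s.2.1 s.2.2)
  let A' : EuclideanSpace ℝ (Fin p₂ × Fin T) :=
    WithLp.toLp 2 (modeProj x fun s => θ'.common s.1 s.2.1 s.2.2)
  have hA : p₁ ^ 2 * p₂ * T * n * rowMoment θ.F j j ≤ ‖A‖ ^ 2 := by
    rw [EuclideanSpace.real_norm_sq_eq]
    show _ ≤ ∑ q, modeProj x (fun s => θ.common s.1 s.2.1 s.2.2) q ^ 2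
    rw [sum_sq_modeProj_common θ hT hC hD.1, hxR]
    have : rowMoment θ.F j j * (p₁ ^ 2 * n) ≤
        ∑ c, rowMoment θ.F c c * ((p₁ : ℝ) • w) c ^ 2 := by
      rw [hn, Finset.mul_sum, Finset.mul_sum]
      refine Finset.sum_le_sum fun c _ => ?_
      rw [Pi.smul_apply, smul_eq_mul, mul_pow]
      rcases le_or_gt c j with hc | hc
      · exact mul_le_mul_of_nonneg_right (hD.2 hc) (by positivity)
      · simp [hwj c hc]
    have := mul_le_mul_of_nonneg_left this (mul_pos hp₂' hT').le
    linarith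
  have hA' : ‖A'‖ ^ 2 ≤ p₁ ^ 2 * p₂ * T * n * e := by
    rw [EuclideanSpace.real_norm_sq_eq]
    show ∑ q, modeProj x (fun s => θ'.common s.1 s.2.1 s.2.2) q ^ 2 ≤ _
    rw [sum_sq_modeProj_common θ' hT hC' hD'.1]
    have h1 : ∑ c, rowMoment θ'.F c c * (x ᵥ* θ'.R) c ^ 2 ≤ e * ∑ c, (x ᵥ* θ'.R) c ^ 2 := by
      rw [Finset.mul_sum]
      refine Finset.sum_le_sum fun c _ => ?_
      rcases lt_or_ge c.val j.val with hc | hc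
      · simp [hxR' c hc]
      · exact mul_le_mul_of_nonneg_right (hle c hc) (sq_nonneg _)
    have h2 := mul_le_mul_of_nonneg_left (sum_sq_vecMul_le_of_normalized hp₁ hR' x) he
    rw [hxn] at h2
    have := mul_le_mul_of_nonneg_left (h1.trans h2) (mul_pos hp₂' hT').le
    linarith
  have hdiff : ‖A - A'‖ ^ 2 ≤ p₁ * n * ∑ s, commonDiff θ θ' s ^ 2 := by
    rw [EuclideanSpace.real_norm_sq_eq, ← hxn]
    refine le_trans (le_of_eq (Finset.sum_congr rfl fun q _ => ?_)) (sum_sq_modeProj_le x _)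
    simp only [A, A', modeProj, commonDiff, WithLp.ofLp_sub, Pi.sub_apply]
    rw [← Finset.sum_sub_distrib]
    congr 1
    exact Finset.sum_congr rfl fun i _ => by ring
  set m := √(p₁ ^ 2 * p₂ * T * n) with hm
  have hm0 : 0 < m := Real.sqrt_pos.2 (by positivity)
  have h1 : m * √(rowMoment θ.F j j) ≤ ‖A‖ := by
    rw [hm, ← Real.sqrt_mul (by positivity)]
    exact Real.sqrt_le_iff.2 ⟨norm_nonneg _, hA⟩
  have h2 : ‖A'‖ ≤ m * √e := by
    rw [hm, ← Real.sqrt_mul (by positivity)]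
    exact Real.le_sqrt_of_sq_le hA'
  have h3 : ‖A - A'‖ ≤ m * √((∑ s, commonDiff θ θ' s ^ 2) / (p₁ * p₂ * T)) := by
    rw [hm, ← Real.sqrt_mul (by positivity)]
    refine Real.le_sqrt_of_sq_le (hdiff.trans (le_of_eq ?_))
    field_simp
  have h4 : ‖A‖ ≤ ‖A'‖ + ‖A - A'‖ := by
    have := norm_add_le A' (A - A')
    rwa [add_sub_cancel] at this
  refine le_of_mul_le_mul_left ?_ hm0
  rw [mul_add]
  linarith

end Weyl

/-! ### From Frobenius distance to exact factor counts -/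

section RankRecovery

variable {p₁ p₂ T : ℕ}

/-- The normalization restrictions of the factor model. -/
structure FactorParam.IsNormalized {a b : ℕ} (θ : FactorParam p₁ p₂ T a b) : Prop where
  loadR : θ.R.transpose * θ.R = (p₁ : ℝ) • (1 : Matrix (Fin a) (Fin a) ℝ)
  loadC : θ.C.transpose * θ.C = (p₂ : ℝ) • (1 : Matrix (Fin b) (Fin b) ℝ)
  row : IsDiagDecreasing (rowMoment θ.F)
  col : IsDiagDecreasing (colMoment θ.F)

theorem FactorParam.IsNormalized.transpose {a b : ℕ} {θ : FactorParam p₁ p₂ T a b}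
    (h : θ.IsNormalized) : θ.transpose.IsNormalized :=
  ⟨h.loadC, h.loadR, θ.rowMoment_transpose ▸ h.col, by
    have : colMoment θ.transpose.F = rowMoment θ.F := by
      simp [rowMoment, colMoment, FactorParam.transpose]
    exact this ▸ h.row⟩

theorem isNormalized_of_mem_paramSpace {a b : ℕ} {𝒜 : Set (Fin a → ℝ)}
    {ℱ : Set (Matrix (Fin a) (Fin b) ℝ)} {ℬ : Set (Fin b → ℝ)} (hp₁ : 0 < p₁) (hp₂ : 0 < p₂)
    {θ : FactorParam p₁ p₂ T a b} (h : θ ∈ paramSpace p₁ p₂ T 𝒜 ℱ ℬ) : θ.IsNormalized := by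
  obtain ⟨-, -, -, hR, hC, hrow, hcol⟩ := h
  have hp₁' : (p₁ : ℝ) ≠ 0 := by exact_mod_cast hp₁.ne'
  have hp₂' : (p₂ : ℝ) ≠ 0 := by exact_mod_cast hp₂.ne'
  exact ⟨by rw [← hR, smul_inv_smul₀ hp₁'], by rw [← hC, smul_inv_smul₀ hp₂'], hrow, hcol⟩

/-- Weyl's inequality is used in both directions. At index `k` the reference model has no factors
left, so `e = 0` and the entry is at most `c`. If an earlier entry were also at most `c`, exchanging
the models would give `√s ≤ 2 * √c`, against `4 * c < s`. -/
theorem rankEstRow_eq {a b k k' : ℕ} {θ : FactorParam p₁ p₂ T a b}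
    {θ' : FactorParam p₁ p₂ T k k'} (hθ : θ.IsNormalized) (hθ' : θ'.IsNormalized) (hp₁ : 0 < p₁)
    (hp₂ : 0 < p₂) (hT : 0 < T) (hk : k < a) {c s : ℝ}
    (hdist : (∑ q, commonDiff θ θ' q ^ 2) / (p₁ * p₂ * T) ≤ c) (hcs : 4 * c < s)
    (hs : ∀ d, s ≤ rowMoment θ'.F d d) : rankEstRow θ c = k := by
  have hc0 : 0 ≤ c := le_trans (by positivity) hdist
  refine countEigenvaluesAbove_eq _ hθ.row hk ?_ fun j hj => ?_
  · have h := sqrt_rowMoment_le θ θ' hp₁ hp₂ hT hθ.loadR hθ.loadC hθ'.loadR hθ'.loadC hθ.row hθ'.row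
      ⟨k, hk⟩ le_rfl fun d hd => absurd d.isLt (not_lt.2 hd)
    rw [Real.sqrt_zero, zero_add] at h
    exact (Real.sqrt_le_sqrt_iff hc0).1 (h.trans (Real.sqrt_le_sqrt hdist))
  · by_contra! hcon
    have hjk : j.val < k := by omega
    have h := sqrt_rowMoment_le θ' θ hp₁ hp₂ hT hθ'.loadR hθ'.loadC hθ.loadR hθ.loadC hθ'.row hθ.row
      ⟨j.val, hjk⟩ hc0 fun d hd => (hθ.row.2 (Fin.le_def.2 hd)).trans hcon
    rw [commonDiff_comm_sq] at h
    have h1 := Real.sqrt_le_sqrt hdist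
    have h2 := Real.sqrt_lt_sqrt (by linarith) (hcs.trans_le (hs ⟨j.val, hjk⟩))
    rw [show 4 * c = 2 ^ 2 * c by ring, Real.sqrt_mul (by norm_num),
      Real.sqrt_sq (by norm_num)] at h2
    linarith

theorem rankEstCol_eq_transpose {a b : ℕ} (θ : FactorParam p₁ p₂ T a b) (c : ℝ) :
    rankEstCol θ c = rankEstRow θ.transpose c := by
  have : ∀ {A A' : Matrix (Fin b) (Fin b) ℝ} (hA : A.IsHermitian) (hA' : A'.IsHermitian),
      A = A' → countEigenvaluesAbove hA c = countEigenvaluesAbove hA' c := by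
    intro A A' hA hA' h
    subst h
    rfl
  exact this _ _ θ.rowMoment_transpose.symm

theorem rankEstCol_eq {a b k k' : ℕ} {θ : FactorParam p₁ p₂ T a b}
    {θ' : FactorParam p₁ p₂ T k k'} (hθ : θ.IsNormalized) (hθ' : θ'.IsNormalized) (hp₁ : 0 < p₁)
    (hp₂ : 0 < p₂) (hT : 0 < T) (hk : k' < b) {c s : ℝ}
    (hdist : (∑ q, commonDiff θ θ' q ^ 2) / (p₁ * p₂ * T) ≤ c) (hcs : 4 * c < s)
    (hs : ∀ d, s ≤ colMoment θ'.F d d) : rankEstCol θ c = k' := by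
  rw [rankEstCol_eq_transpose]
  refine rankEstRow_eq hθ.transpose hθ'.transpose hp₂ hp₁ hT hk ?_ hcs fun d => ?_
  · rw [sum_sq_commonDiff_transpose, mul_comm (p₂ : ℝ)]
    exact hdist
  · rw [FactorParam.rowMoment_transpose]
    exact hs d

end RankRecovery

/-! ### Zero padding and the basic inequality for the minimizer -/

section Padding

variable {p₁ p₂ T : ℕ}

theorem sum_fin_castLE {k K : ℕ} (h : k ≤ K) (f : Fin K → ℝ) (hf : ∀ c, k ≤ c.val → f c = 0) :
    ∑ c, f c = ∑ c : Fin k, f (Fin.castLE h c) := by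
  refine (Fintype.sum_of_injective (Fin.castLE h) (Fin.castLE_injective h) _ f
    (fun c hc => hf c ?_) fun _ => rfl).symm
  by_contra! hlt
  exact hc ⟨⟨c.val, hlt⟩, rfl⟩

/-- Padding the factors by zeros does not change the common component. -/
theorem common_padFactor {k₁ k₂ K₁ K₂ : ℕ} (h₁ : k₁ ≤ K₁) (h₂ : k₂ ≤ K₂)
    {R₀ : Matrix (Fin p₁) (Fin k₁) ℝ} {C₀ : Matrix (Fin p₂) (Fin k₂) ℝ}
    {R : Matrix (Fin p₁) (Fin K₁) ℝ} {C : Matrix (Fin p₂) (Fin K₂) ℝ}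
    (hR : ExtendsColumns h₁ R₀ R) (hC : ExtendsColumns h₂ C₀ C)
    (F : Fin T → Matrix (Fin k₁) (Fin k₂) ℝ) (i : Fin p₁) (j : Fin p₂) (t : Fin T) :
    (⟨R, fun t => padFactor K₁ K₂ (F t), C⟩ : FactorParam p₁ p₂ T K₁ K₂).common i j t =
      (⟨R₀, F, C₀⟩ : FactorParam p₁ p₂ T k₁ k₂).common i j t := by
  rw [FactorParam.common_eq_sum, FactorParam.common_eq_sum, sum_fin_castLE h₂]
  · refine Finset.sum_congr rfl fun d _ => ?_
    rw [sum_fin_castLE h₁]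
    · dsimp only
      rw [hC j d]
      congr 1
      refine Finset.sum_congr rfl fun c _ => ?_
      rw [hR i c]
      simp [padFactor]
    · intro c hc
      simp [padFactor, not_lt.2 hc]
  · intro d hd
    rw [Finset.sum_eq_zero fun c _ => by simp [padFactor, not_lt.2 hd], zero_mul]

/-- The estimator does not increase the loss compared to the true common component. -/
theorem sum_lossIncr_nonpos {a b k₁ k₂ K₁ K₂ : ℕ} {τ : ℝ} (hp₁ : 0 < p₁) (hp₂ : 0 < p₂)
    (hT : 0 < T) {x : Fin p₁ × Fin p₂ × Fin T → ℝ} {θ : FactorParam p₁ p₂ T a b}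
    {θ₀ : FactorParam p₁ p₂ T k₁ k₂} {θpad : FactorParam p₁ p₂ T K₁ K₂}
    (hpad : ∀ i j t, θpad.common i j t = θ₀.common i j t)
    (hmin : empiricalLoss τ x θ ≤ empiricalLoss τ x θpad) :
    ∑ s, lossIncr τ (idioError x θ₀ s) (commonDiff θ θ₀ s) ≤ 0 := by
  have hpos : (0 : ℝ) < ((p₁ : ℝ) * p₂ * T)⁻¹ := by
    have hp₁' : (0 : ℝ) < p₁ := by exact_mod_cast hp₁
    have hp₂' : (0 : ℝ) < p₂ := by exact_mod_cast hp₂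
    have hT' : (0 : ℝ) < T := by exact_mod_cast hT
    positivity
  have h := le_of_mul_le_mul_left hmin hpos
  have hsum : ∑ s, lossIncr τ (idioError x θ₀ s) (commonDiff θ θ₀ s) =
      ∑ i, ∑ j, ∑ t, checkLoss τ (x (i, j, t) - θ.common i j t) -
        ∑ i, ∑ j, ∑ t, checkLoss τ (x (i, j, t) - θpad.common i j t) := by
    simp only [lossIncr, idioError, commonDiff, Fintype.sum_prod_type, hpad,
      Finset.sum_sub_distrib, sub_sub, add_sub_cancel]
  rw [hsum]
  linarith

end Padding

/-! ### Conditioning on the factors, limits in probability and the rate -/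

section Probability

theorem measure_preimage_le_of_condDistrib_le {Ω β E : Type*} [MeasurableSpace Ω]
    [MeasurableSpace β] [MeasurableSpace E] [StandardBorelSpace E] [Nonempty E] {P : Measure Ω}
    [IsProbabilityMeasure P] {X : Ω → β} {Y : Ω → E} (hX : Measurable X) (hY : Measurable Y)
    {U : Set E} (hU : MeasurableSet U) {b : ENNReal}
    (h : ∀ᵐ φ ∂(P.map X), condDistrib Y X P φ U ≤ b) : P {ω | Y ω ∈ U} ≤ b := by
  have := Measure.isProbabilityMeasure_map (μ := P) hX.aemeasurable
  calc P {ω | Y ω ∈ U} = (P.map Y) U := (Measure.map_apply hY hU).symm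
    _ = ∫⁻ φ, condDistrib Y X P φ U ∂(P.map X) := by
        rw [← condDistrib_comp_map hX.aemeasurable hY.aemeasurable,
          Measure.bind_apply hU (Kernel.aemeasurable _)]
    _ ≤ ∫⁻ _φ, b ∂(P.map X) := lintegral_mono_ae h
    _ = b := by simp

theorem measurable_idioError {Ω : Type*} [MeasurableSpace Ω] {p₁ p₂ T a b : ℕ}
    (R : Matrix (Fin p₁) (Fin a) ℝ) (C : Matrix (Fin p₂) (Fin b) ℝ)
    {F : Ω → Fin T → Matrix (Fin a) (Fin b) ℝ} {X : Ω → Fin p₁ × Fin p₂ × Fin T → ℝ}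
    (hF : Measurable F) (hX : Measurable X) :
    Measurable fun ω => idioError (X ω) (⟨R, F ω, C⟩ : FactorParam p₁ p₂ T a b) := by
  refine measurable_pi_iff.2 fun s => ?_
  simp only [idioError, FactorParam.common_eq_sum]
  refine ((measurable_pi_apply s).comp hX).sub (Finset.measurable_sum _ fun d _ =>
    (Finset.measurable_sum _ fun c _ => Measurable.const_mul ?_ _).mul_const _)
  exact (measurable_pi_apply d).comp ((measurable_pi_apply (X := fun _ => Fin b → ℝ) c).comp
    ((measurable_pi_apply s.2.2).comp hF))

/-- Coordinates converging in probability to positive limits exceed half of these limits. -/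
theorem tendsto_measure_exists_lt_of_tendstoInMeasure {Ω N ι : Type*} [MeasurableSpace Ω]
    [Fintype ι] {P : Measure Ω} {l : Filter N} {D : ι → N → Ω → ℝ} {σ : ι → ℝ} {s : ℝ}
    (hs : 0 < s) (hσ : ∀ a, 2 * s ≤ σ a)
    (h : ∀ a, TendstoInMeasure P (D a) l fun _ => σ a) :
    Tendsto (fun n => P {ω | ∃ a, D a n ω < s}) l (𝓝 0) := by
  have hsum : Tendsto (fun n => ∑ a, P {ω | s ≤ ‖D a n ω - σ a‖}) l (𝓝 0) := by
    have := tendsto_finsetSum Finset.univ fun a _ => tendstoInMeasure_iff_norm.1 (h a) s hs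
    simpa using this
  refine tendsto_of_tendsto_of_tendsto_of_le_of_le tendsto_const_nhds hsum
    (fun _ => zero_le) fun n => ?_
  refine le_trans (measure_mono fun ω hω => ?_) (measure_iUnion_fintype_le P
    fun a => {ω | s ≤ ‖D a n ω - σ a‖})
  obtain ⟨a, ha⟩ := hω
  refine Set.mem_iUnion.2 ⟨a, ?_⟩
  show s ≤ ‖D a n ω - σ a‖
  rw [Real.norm_eq_abs, abs_sub_comm]
  exact le_trans (by linarith [hσ a]) (le_abs_self _)

theorem exists_pos_two_mul_le {ι ι' : Type*} [Finite ι] [Finite ι'] {σ : ι → ℝ} {σ' : ι' → ℝ}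
    (hσ : ∀ a, 0 < σ a) (hσ' : ∀ b, 0 < σ' b) :
    ∃ s : ℝ, 0 < s ∧ (∀ a, 2 * s ≤ σ a) ∧ ∀ b, 2 * s ≤ σ' b := by
  have h1 : ∀ a, ∀ᶠ s : ℝ in 𝓝[>] 0, 2 * s ≤ σ a := fun a =>
    eventually_nhdsWithin_of_eventually_nhds ((eventually_le_nhds (half_pos (hσ a))).mono
      fun s hs => by linarith)
  have h2 : ∀ b, ∀ᶠ s : ℝ in 𝓝[>] 0, 2 * s ≤ σ' b := fun b =>
    eventually_nhdsWithin_of_eventually_nhds ((eventually_le_nhds (half_pos (hσ' b))).mono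
      fun s hs => by linarith)
  obtain ⟨s, hs⟩ := (eventually_mem_nhdsWithin.and
    ((eventually_all.2 h1).and (eventually_all.2 h2))).exists
  exact ⟨s, hs.1, hs.2.1, hs.2.2⟩

theorem tendsto_measure_one_of_forall_pos {Ω N : Type*} [MeasurableSpace Ω] {P : Measure Ω}
    [IsProbabilityMeasure P] {l : Filter N} {E : N → Set Ω}
    (h : ∀ η : ℝ, 0 < η → ∀ᶠ n in l, 1 ≤ P (E n) + ENNReal.ofReal η) :
    Tendsto (fun n => P (E n)) l (𝓝 1) := by
  refine tendsto_order.2 ⟨fun a ha => ?_, fun a ha => Eventually.of_forall fun n =>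
    prob_le_one.trans_lt ha⟩
  obtain ⟨η, hη0, hη⟩ := ENNReal.lt_iff_exists_add_pos_lt.1 ha
  filter_upwards [h η (by exact_mod_cast hη0)] with n hn
  rw [ENNReal.ofReal_coe_nnreal] at hn
  exact lt_of_add_lt_add_right (hη.trans_le hn)

/-- The squared rate `3 A² / L²` dominates `A²` times the number of parameters per observation. -/
theorem mul_dim_div_le_of_le_mul_rateL {p₁ p₂ T : ℕ} (hp₁ : 0 < p₁) (hp₂ : 0 < p₂) (hT : 0 < T)
    {A c : ℝ} (hc : 0 ≤ c) (h : 3 * A ^ 2 ≤ c * rateL p₁ p₂ T ^ 2) :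
    (A * √((p₁ + p₂ + T : ℕ) : ℝ)) ^ 2 / (p₁ * p₂ * T) ≤ c := by
  have hp₁' : (0 : ℝ) < p₁ := by exact_mod_cast hp₁
  have hp₂' : (0 : ℝ) < p₂ := by exact_mod_cast hp₂
  have hT' : (0 : ℝ) < T := by exact_mod_cast hT
  have hL0 : 0 ≤ rateL p₁ p₂ T :=
    le_min (Real.sqrt_nonneg _) (le_min (Real.sqrt_nonneg _) (Real.sqrt_nonneg _))
  -- The quotient `(p₁ + p₂ + T) / (p₁ p₂ T)` is the sum of the reciprocals of `p₁ p₂`, `p₂ T` and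
  -- `p₁ T`, each of which is at least `L ^ 2`.
  have hle : ∀ y : ℝ, 0 ≤ y → rateL p₁ p₂ T ≤ √y → 3 * A ^ 2 ≤ c * y := fun y hy hLy =>
    h.trans (mul_le_mul_of_nonneg_left ((Real.le_sqrt hL0 hy).1 hLy) hc)
  have h1 := hle (p₁ * p₂) (by positivity) (min_le_left _ _)
  have h2 := hle (p₂ * T) (by positivity) ((min_le_right _ _).trans (min_le_left _ _))
  have h3 := hle (p₁ * T) (by positivity) ((min_le_right _ _).trans (min_le_right _ _))
  rw [div_le_iff₀ (by positivity), mul_pow, Real.sq_sqrt (by positivity)]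
  push_cast
  have h1' := mul_le_mul_of_nonneg_right h1 hT'.le
  have h2' := mul_le_mul_of_nonneg_right h2 hp₁'.le
  have h3' := mul_le_mul_of_nonneg_right h3 hp₂'.le
  linarith

end Probability

/-! ### Consistency of the estimated numbers of factors -/

theorem theorem4p1 {Ω : Type*} [MeasurableSpace Ω] (P : Measure Ω) [IsProbabilityMeasure P]
    (τ : ℝ) (hτ0 : 0 < τ) (hτ1 : τ < 1)
    -- true and overspecified numbers of factors
    (k₁ k₂ K₁ K₂ : ℕ) (hK₁ : k₁ < K₁) (hK₂ : k₂ < K₂)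
    -- compact sets of loadings and factors, for the true and for the overspecified model
    (𝒜 : Set (Fin k₁ → ℝ)) (ℱ : Set (Matrix (Fin k₁) (Fin k₂) ℝ)) (ℬ : Set (Fin k₂ → ℝ))
    (h𝒜 : IsCompact 𝒜) (hℱ : IsCompact ℱ) (hℬ : IsCompact ℬ)
    (𝒜K : Set (Fin K₁ → ℝ)) (ℱK : Set (Matrix (Fin K₁) (Fin K₂) ℝ)) (ℬK : Set (Fin K₂ → ℝ))
    (h𝒜K : IsCompact 𝒜K) (hℱK : IsCompact ℱK) (hℬK : IsCompact ℬK)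
    -- true loadings (not random), true factors (random) and the observed data
    (R₀ : ∀ p₁ _p₂ _T : ℕ, Matrix (Fin p₁) (Fin k₁) ℝ)
    (C₀ : ∀ _p₁ p₂ _T : ℕ, Matrix (Fin p₂) (Fin k₂) ℝ)
    (F₀ : ∀ _p₁ _p₂ T : ℕ, Ω → Fin T → Matrix (Fin k₁) (Fin k₂) ℝ)
    (X : ∀ p₁ p₂ T : ℕ, Ω → Fin p₁ × Fin p₂ × Fin T → ℝ)
    (hF₀ : ∀ p₁ p₂ T, Measurable (F₀ p₁ p₂ T)) (hX : ∀ p₁ p₂ T, Measurable (X p₁ p₂ T))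
    -- the true parameter lies in the parameter space
    (hθ₀ : ∀ᶠ n : ℕ × ℕ × ℕ in atTop, ∀ᵐ ω ∂P,
      (⟨R₀ n.1 n.2.1 n.2.2, F₀ n.1 n.2.1 n.2.2 ω, C₀ n.1 n.2.1 n.2.2⟩ :
        FactorParam n.1 n.2.1 n.2.2 k₁ k₂) ∈ paramSpace n.1 n.2.1 n.2.2 𝒜 ℱ ℬ)
    -- the overspecified parameter space contains the true parameter, its factors padded by zeros
    (hpad : ∀ᶠ n : ℕ × ℕ × ℕ in atTop,
      ∃ (R : Matrix (Fin n.1) (Fin K₁) ℝ) (C : Matrix (Fin n.2.1) (Fin K₂) ℝ),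
        ExtendsColumns hK₁.le (R₀ n.1 n.2.1 n.2.2) R ∧
        ExtendsColumns hK₂.le (C₀ n.1 n.2.1 n.2.2) C ∧
        ∀ᵐ ω ∂P,
          (⟨R, fun t => padFactor K₁ K₂ (F₀ n.1 n.2.1 n.2.2 ω t), C⟩ :
            FactorParam n.1 n.2.1 n.2.2 K₁ K₂) ∈ paramSpace n.1 n.2.1 n.2.2 𝒜K ℱK ℬK)
    -- the diagonal entries of the true second-moment matrices have positive limits
    (σ : Fin k₁ → ℝ) (σ' : Fin k₂ → ℝ) (hσ : ∀ a, 0 < σ a) (hσ' : ∀ b, 0 < σ' b)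
    (hσlim : ∀ a, TendstoInMeasure P
      (fun (n : ℕ × ℕ × ℕ) ω => rowMoment (F₀ n.1 n.2.1 n.2.2 ω) a a) atTop (fun _ => σ a))
    (hσlim' : ∀ b, TendstoInMeasure P
      (fun (n : ℕ × ℕ × ℕ) ω => colMoment (F₀ n.1 n.2.1 n.2.2 ω) b b) atTop (fun _ => σ' b))
    -- given the factors, the errors are independent with densities `f`
    -- whose `τ`-quantile is zero and which are bounded below on compact sets
    (f : ∀ p₁ p₂ T : ℕ, Fin p₁ × Fin p₂ × Fin T →
      (Fin T → Matrix (Fin k₁) (Fin k₂) ℝ) → ℝ → ℝ)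
    (hf : ∀ᶠ n : ℕ × ℕ × ℕ in atTop, ∀ᵐ φ ∂(P.map (F₀ n.1 n.2.1 n.2.2)),
      ∀ s, IsDensityWithZeroQuantile τ (f n.1 n.2.1 n.2.2 s φ))
    (hlaw : ∀ᶠ n : ℕ × ℕ × ℕ in atTop, ∀ᵐ φ ∂(P.map (F₀ n.1 n.2.1 n.2.2)),
      condDistrib
        (fun ω => idioError (X n.1 n.2.1 n.2.2 ω)
          ⟨R₀ n.1 n.2.1 n.2.2, F₀ n.1 n.2.1 n.2.2 ω, C₀ n.1 n.2.1 n.2.2⟩)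
        (F₀ n.1 n.2.1 n.2.2) P φ =
      Measure.pi fun s =>
        (volume : Measure ℝ).withDensity fun u => ENNReal.ofReal (f n.1 n.2.1 n.2.2 s φ u))
    (hflow : ∀ S : Set ℝ, IsCompact S → ∃ c : ℝ, 0 < c ∧
      ∀ᶠ n : ℕ × ℕ × ℕ in atTop, ∀ᵐ φ ∂(P.map (F₀ n.1 n.2.1 n.2.2)),
        ∀ s, ∀ u ∈ S, c ≤ f n.1 n.2.1 n.2.2 s φ u)
    -- the estimator of the overspecified model: a measurable minimizer of the check loss
    (θhat : ∀ p₁ p₂ T : ℕ, Ω → FactorParam p₁ p₂ T K₁ K₂)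
    (hθmeas : ∀ p₁ p₂ T, Measurable (fun ω => (θhat p₁ p₂ T ω).R) ∧
      Measurable (fun ω => (θhat p₁ p₂ T ω).F) ∧ Measurable (fun ω => (θhat p₁ p₂ T ω).C))
    (hθmin : ∀ᶠ n : ℕ × ℕ × ℕ in atTop, ∀ᵐ ω ∂P,
      θhat n.1 n.2.1 n.2.2 ω ∈ paramSpace n.1 n.2.1 n.2.2 𝒜K ℱK ℬK ∧
      ∀ θ ∈ paramSpace n.1 n.2.1 n.2.2 𝒜K ℱK ℬK,
        empiricalLoss τ (X n.1 n.2.1 n.2.2 ω) (θhat n.1 n.2.1 n.2.2 ω) ≤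
          empiricalLoss τ (X n.1 n.2.1 n.2.2 ω) θ)
    -- the threshold
    (thr : ℕ → ℕ → ℕ → ℝ)
    (hthr0 : Tendsto (fun n : ℕ × ℕ × ℕ => thr n.1 n.2.1 n.2.2) atTop (𝓝 0))
    (hthr : Tendsto (fun n : ℕ × ℕ × ℕ =>
      thr n.1 n.2.1 n.2.2 * rateL n.1 n.2.1 n.2.2 ^ 2) atTop atTop) :
    Tendsto (fun n : ℕ × ℕ × ℕ => P {ω |
        rankEstRow (θhat n.1 n.2.1 n.2.2 ω) (thr n.1 n.2.1 n.2.2) = k₁ ∧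
        rankEstCol (θhat n.1 n.2.1 n.2.2 ω) (thr n.1 n.2.1 n.2.2) = k₂})
      atTop (𝓝 1) := by
  obtain ⟨B₁, hB₁⟩ := exists_common_bound h𝒜K hℱK hℬK
  obtain ⟨B₂, hB₂⟩ := exists_common_bound h𝒜 hℱ hℬ
  -- Differences of estimated and true common components are bounded by `B₁ + B₂`, so the density
  -- bound is needed only on this interval.
  obtain ⟨c, hc, hfc⟩ := hflow (Set.Icc (-(B₁ + B₂)) (B₁ + B₂)) isCompact_Icc
  obtain ⟨s, hs, hsσ, hsσ'⟩ := exists_pos_two_mul_le hσ hσ'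
  have hrow := tendsto_measure_exists_lt_of_tendstoInMeasure hs hsσ hσlim
  have hcol := tendsto_measure_exists_lt_of_tendstoInMeasure hs hsσ' hσlim'
  refine tendsto_measure_one_of_forall_pos fun η hη => ?_
  have hη3 : (0 : ℝ) < η / 3 := by positivity
  set κ : ℝ := ((K₁ + k₁ : ℕ) : ℝ) * ((K₂ + k₂ : ℕ) : ℝ) with hκ
  have hκ0 : 0 ≤ κ := by positivity
  -- Chosen so that the bad event at radius `A * √(p₁ + p₂ + T)` has probability at most `η / 3`,
  -- whatever the dimensions; the `+ 1` gives `0 < A` from `0 ≤ κ` alone. The other two thirds of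
  -- `η` pay for small row or column moments of the true factors.
  set A : ℝ := 224 * κ / (c * (η / 3)) + 1 with hA
  have hA0 : 0 < A := by positivity
  have hAη : 224 * κ / (c * A) ≤ η / 3 := by
    rw [div_le_iff₀ (by positivity), hA, mul_add, mul_add, mul_one]
    have : η / 3 * (c * (224 * κ / (c * (η / 3)))) = 224 * κ := by
      field_simp
    rw [this]
    have : 0 < η / 3 * c := by positivity
    linarith
  filter_upwards [eventually_ge_atTop ((1, 1, 1) : ℕ × ℕ × ℕ), hθ₀, hpad, hf, hlaw, hfc, hθmin,
    hrow.eventually_le_const (ENNReal.ofReal_pos.2 hη3),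
    hcol.eventually_le_const (ENNReal.ofReal_pos.2 hη3),
    hthr0.eventually_lt_const (show (0 : ℝ) < s / 4 by positivity),
    hthr.eventually_ge_atTop (3 * A ^ 2)] with n hn hθ₀n hpadn hfn hlawn hfcn hminn hrown hcoln
    hthrs hthrA
  obtain ⟨p₁, p₂, T⟩ := n
  simp only at hθ₀n hpadn hfn hlawn hfcn hminn hrown hcoln hthrs hthrA ⊢
  have hp₁ : 0 < p₁ := hn.1
  have hp₂ : 0 < p₂ := hn.2.1
  have hT : 0 < T := hn.2.2
  obtain ⟨R, C, hR, hC, hpadn⟩ := hpadn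
  have hdim : 0 < p₁ + p₂ + T := by omega
  have hsqrt : 0 < √((p₁ + p₂ + T : ℕ) : ℝ) := Real.sqrt_pos.2 (by exact_mod_cast hdim)
  set r : ℝ := A * √((p₁ + p₂ + T : ℕ) : ℝ) with hr
  have hr0 : 0 < r := mul_pos hA0 hsqrt
  have ha0 : 0 < c / 4 * r ^ 2 := by positivity
  set c' : ℝ := thr p₁ p₂ T with hc'
  have hc'0 : 0 ≤ c' := by
    by_contra! hneg
    have h1 : c' * rateL p₁ p₂ T ^ 2 ≤ 0 :=
      mul_nonpos_of_nonpos_of_nonneg hneg.le (sq_nonneg _)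
    have h2 : 0 < 3 * A ^ 2 := by positivity
    linarith
  set bad := badErrors p₁ p₂ T (K₁ + k₁) (K₂ + k₂) τ (B₁ + B₂) r (c / 4 * r ^ 2) with hbad
  set ε : Ω → Fin p₁ × Fin p₂ × Fin T → ℝ := fun ω => idioError (X p₁ p₂ T ω)
    ⟨R₀ p₁ p₂ T, F₀ p₁ p₂ T ω, C₀ p₁ p₂ T⟩ with hε
  have hbadP : P {ω | ε ω ∈ bad} ≤ ENNReal.ofReal (η / 3) := by
    refine measure_preimage_le_of_condDistrib_le (hF₀ p₁ p₂ T)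
      (measurable_idioError _ _ (hF₀ p₁ p₂ T) (hX p₁ p₂ T))
      (isOpen_badErrors _ _ _ _ _ _ _ _ _).measurableSet ?_
    filter_upwards [hfn, hlawn, hfcn] with φ h1 h2 h3
    rw [h2]
    refine (measure_badErrors_le hτ0 hτ1 hr0 hc hdim (fun s => f p₁ p₂ T s φ) h1 h3).trans
      (ENNReal.ofReal_le_ofReal (le_trans (le_of_eq ?_) hAη))
    rw [hr, hκ]
    field_simp
  -- Outside the three exceptional events the argument is deterministic: loss comparison, radius
  -- bound, then Weyl's inequality.
  have hgood : ∀ᵐ ω ∂P, ω ∈ {ω | rankEstRow (θhat p₁ p₂ T ω) c' = k₁ ∧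
      rankEstCol (θhat p₁ p₂ T ω) c' = k₂} ∪ ({ω | ε ω ∈ bad} ∪
      ({ω | ∃ a, rowMoment (F₀ p₁ p₂ T ω) a a < s} ∪
        {ω | ∃ b, colMoment (F₀ p₁ p₂ T ω) b b < s})) := by
    filter_upwards [hθ₀n, hpadn, hminn] with ω hω₀ hωpad hωmin
    by_contra hcon
    simp only [Set.mem_union, Set.mem_ofPred_eq, not_or, not_exists, not_lt] at hcon
    obtain ⟨hcon, hωbad, hωrow, hωcol⟩ := hcon
    set θ₀ : FactorParam p₁ p₂ T k₁ k₂ := ⟨R₀ p₁ p₂ T, F₀ p₁ p₂ T ω, C₀ p₁ p₂ T⟩ with hθ₀def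
    have hloss := sum_lossIncr_nonpos (τ := τ) hp₁ hp₂ hT (x := X p₁ p₂ T ω)
      (θ := θhat p₁ p₂ T ω) (θ₀ := θ₀)
      (common_padFactor hK₁.le hK₂.le hR hC (F₀ p₁ p₂ T ω)) (hωmin.2 _ hωpad)
    have hsq := sum_sq_le_of_notMem_badErrors hr0 ha0 hωbad
      (hasModeRankLE_commonDiff (θhat p₁ p₂ T ω) θ₀) (fun q => (abs_sub _ _).trans
        (add_le_add (hB₁ _ _ _ _ hωmin.1 _ _ _) (hB₂ _ _ _ _ hω₀ _ _ _))) hloss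
    have hdist : (∑ q, commonDiff (θhat p₁ p₂ T ω) θ₀ q ^ 2) / (p₁ * p₂ * T) ≤ c' :=
      (div_le_div_of_nonneg_right hsq (by positivity)).trans
        (mul_dim_div_le_of_le_mul_rateL hp₁ hp₂ hT hc'0 hthrA)
    have hN := isNormalized_of_mem_paramSpace hp₁ hp₂ hωmin.1
    have hN₀ := isNormalized_of_mem_paramSpace hp₁ hp₂ hω₀
    exact hcon ⟨rankEstRow_eq hN hN₀ hp₁ hp₂ hT hK₁ hdist (by linarith) hωrow,
      rankEstCol_eq hN hN₀ hp₁ hp₂ hT hK₂ hdist (by linarith) hωcol⟩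
  have hone : (1 : ENNReal) ≤ P {ω | rankEstRow (θhat p₁ p₂ T ω) c' = k₁ ∧
      rankEstCol (θhat p₁ p₂ T ω) c' = k₂} + (P {ω | ε ω ∈ bad} +
      (P {ω | ∃ a, rowMoment (F₀ p₁ p₂ T ω) a a < s} +
        P {ω | ∃ b, colMoment (F₀ p₁ p₂ T ω) b b < s})) := by
    rw [← measure_univ (μ := P)]
    refine (measure_mono_ae (hgood.mono fun ω hω _ => hω)).trans
      ((measure_union_le _ _).trans (add_le_add le_rfl ?_))
    exact (measure_union_le _ _).trans (add_le_add le_rfl (measure_union_le _ _))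
  refine hone.trans (add_le_add le_rfl ?_)
  refine (add_le_add hbadP (add_le_add hrown hcoln)).trans (le_of_eq ?_)
  rw [← ENNReal.ofReal_add hη3.le hη3.le, ← ENNReal.ofReal_add hη3.le (by positivity)]
  congr 1
  ring
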